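/- **Setting.** For $i=1,2$ let $N_i$ be a complex nuclear Fréchet space whose topology is defined by increasing Hilbertian norms $|\cdot|_{i,p}$, $p\in\mathbb N$, and which is the complexification of a real space on which the inner product of $|\cdot|_{i,0}$ is real. Let $\langle\cdot,\cdot\rangle_i$ denote the $\mathbb C$-bilinear extension to $N_i$ of this real inner product, and also the bilinear pairing of the dual $N_i'$ with $N_i$. Let $(N_i)_p$ be the completion of $N_i$ for $|\cdot|_{i,p}$, and $(N_i)_{-p}$ its dual, with dual norm $|\cdot|_{i,-p}$; thus $N_i'=\bigcup_p (N_i)_{-p}$. Let $\theta_1,\theta_2$ be Young functions: continuous, convex, increasing functions on $[0,\infty)$ with $\theta_i(0)=0$ and $\lim_{x\to\infty}\theta_i(x)/x=\infty$. Let $\mathcal F_{\theta_i}(N_i')$ be the space of functions $\varphi$ on $N_i'$ whose restriction to each $(N_i)_{-p}$ is entire, with $$\sup_{z\in (N_i)_{-p}}|\varphi(z)|\,e^{-\theta_i(a|z|_{i,-p})}<\infty\qquad\text{for all }p\in\mathbb N,\ a>0,$$ topologized by these norms. Likewise, let $\mathcal F_{(\theta_1,\theta_2)}(N_1'\times N_2')$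 be the space of functions on $N_1'\times N_2'$ which are entire on each $(N_1)_{-p}\times(N_2)_{-q}$, with $$\sup|\varphi(z_1,z_2)|\,e^{-\theta_1(a_1|z_1|_{1,-p})-\theta_2(a_2|z_2|_{2,-q})}<\infty\qquad\text{for all }p,q\in\mathbb N,\ a_1,a_2>0,$$ topologized by these norms. A star denotes the (strong) topological dual, and $\langle\langle\cdot,\cdot\rangle\rangle$ its pairing with the space. Put $e_\xi(z)=e^{\langle z,\xi\rangle_i}$ for $\xi\in N_i$. For $\Phi,\Psi\in\mathcal F^*_{(\theta_1,\theta_2)}(N_1'\times N_2')$ and $\varphi\in\mathcal F_{(\theta_1,\theta_2)}(N_1'\times N_2')$ let $$(\Phi*\varphi)(z)=\langle\langle\Phi,\varphi(\cdot+z)\rangle\rangle,\qquad \langle\langle\Psi*\Phi,\varphi\rangle\rangle=\langle\langle\Psi,\Phi*\varphi\rangle\rangle .$$ Let $\tau_i$ be the trace functional on $N_i\hat\otimes N_i$, determined by $\langle\tau_i,\xi\otimes\eta\rangle=\langle\xi,\eta\rangle_i$, and let $\mathcal T\in\mathcal F^*_{(\theta_1,\theta_2)}(N_1'\times N_2')$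 be the distribution with Taylor coefficients $\mathcal T_{2,0}=\tau_1$, $\mathcal T_{0,2}=\tau_2$ and $\mathcal T_{n,m}=0$ otherwise; that is, $$\langle\langle\mathcal T,\varphi\rangle\rangle=2!\,\langle\tau_1,\varphi_{2,0}\rangle+2!\,\langle\tau_2,\varphi_{0,2}\rangle\qquad\text{for }\ \varphi(x,y)=\sum_{n,m}\langle x^{\otimes n}\otimes y^{\otimes m},\varphi_{n,m}\rangle .$$ Every continuous linear operator $\Xi\in\mathcal L(\mathcal F_{\theta_1}(N_1'),\mathcal F^*_{\theta_2}(N_2'))$ has a kernel $\Xi^K\in\mathcal F^*_{(\theta_1,\theta_2)}(N_1'\times N_2')$, given by $\langle\langle\Xi\varphi,\psi\rangle\rangle=\langle\langle\Xi^K,\varphi\otimes\psi\rangle\rangle$ for all $\varphi\in\mathcal F_{\theta_1}(N_1')$, $\psi\in\mathcal F_{\theta_2}(N_2')$. The symbol of $\Xi$ is $\sigma(\Xi)(\xi_1,\xi_2)=\langle\langle\Xi e_{\xi_1},e_{\xi_2}\rangle\rangle$. The quantum Gross Laplacian $\Delta_G^Q(\Xi)$ is the operator with kernel $\mathcal T*\Xi^K$.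 **Proposition.** For every $\Xi\in\mathcal L(\mathcal F_{\theta_1}(N_1'),\mathcal F^*_{\theta_2}(N_2'))$ and all $(\xi_1,\xi_2)\in N_1\times N_2$, $$\sigma(\Delta_G^Q(\Xi))(\xi_1,\xi_2)=\bigl(\langle\xi_1,\xi_1\rangle_1+\langle\xi_2,\xi_2\rangle_2\bigr)\,\sigma(\Xi)(\xi_1,\xi_2).$$ -/

import Mathlib

noncomputable section

namespace WhiteNoise

open Filter Topology Complex

/-! ### Young functions -/

/-- A Young function, given by its values on `[0, ∞)`: continuous, convex, increasing, vanishing at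
`0` and growing faster than linearly. -/
structure YoungFunction where
  toFun : ℝ → ℝ
  continuousOn : ContinuousOn toFun (Set.Ici 0)
  convexOn : ConvexOn ℝ (Set.Ici 0) toFun
  monotoneOn : MonotoneOn toFun (Set.Ici 0)
  map_zero : toFun 0 = 0
  superlinear : Tendsto (fun x => toFun x / x) atTop atTop

instance : CoeFun YoungFunction (fun _ => ℝ → ℝ) := ⟨YoungFunction.toFun⟩

namespace YoungFunction

variable (θ : YoungFunction)

theorem mono {x y : ℝ} (hx : 0 ≤ x) (hxy : x ≤ y) : θ x ≤ θ y :=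
  θ.monotoneOn hx (hx.trans hxy) hxy

theorem nonneg {x : ℝ} (hx : 0 ≤ x) : 0 ≤ θ x := by
  simpa [θ.map_zero] using θ.mono le_rfl hx

/-- Splitting of the growth exponent of a sum, at the cost of halving the scale. -/
theorem le_add {a b c s t u : ℝ} (hc : 0 ≤ c) (ha : 2 * c ≤ a) (hb : 2 * c ≤ b)
    (hs : 0 ≤ s) (ht : 0 ≤ t) (hu : 0 ≤ u) (h : u ≤ s + t) :
    θ (c * u) ≤ θ (a * s) + θ (b * t) := by
  have h1 : c * u ≤ (1 / 2 : ℝ) • (a * s) + (1 / 2 : ℝ) • (b * t) := by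
    simp only [smul_eq_mul]
    nlinarith [mul_le_mul_of_nonneg_left h hc, mul_le_mul_of_nonneg_right ha hs,
      mul_le_mul_of_nonneg_right hb ht]
  have has : 0 ≤ a * s := mul_nonneg (by linarith) hs
  have hbt : 0 ≤ b * t := mul_nonneg (by linarith) ht
  have h2 : θ ((1 / 2 : ℝ) • (a * s) + (1 / 2 : ℝ) • (b * t)) ≤
      (1 / 2 : ℝ) • θ (a * s) + (1 / 2 : ℝ) • θ (b * t) :=
    θ.convexOn.2 has hbt (by norm_num) (by norm_num) (by norm_num)
  have h3 := θ.mono (mul_nonneg hc hu) h1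
  simp only [smul_eq_mul] at h2 h3
  linarith [θ.nonneg has, θ.nonneg hbt]

theorem exists_linear_le {a : ℝ} (ha : 0 < a) (M : ℝ) (hM : 0 ≤ M) :
    ∃ C : ℝ, ∀ s : ℝ, 0 ≤ s → M * s ≤ C + θ (a * s) := by
  obtain ⟨x₀, hx₀⟩ := (θ.superlinear.eventually_ge_atTop (M / a)).exists_forall_of_atTop
  refine ⟨M / a * max x₀ 0, fun s hs => ?_⟩
  have has : 0 ≤ a * s := mul_nonneg ha.le hs
  have hMa : 0 ≤ M / a := div_nonneg hM ha.le
  have e : M * s = M / a * (a * s) := by field_simp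
  rcases le_total (a * s) (max x₀ 0) with h | h
  · have := mul_le_mul_of_nonneg_left h hMa
    linarith [θ.nonneg has]
  · rcases has.eq_or_lt with h0 | h0
    · rw [e, ← h0]
      simp only [mul_zero]
      have := mul_nonneg hMa (le_max_right x₀ 0)
      linarith [θ.nonneg le_rfl]
    · have := hx₀ (a * s) ((le_max_left _ _).trans h)
      rw [le_div_iff₀ h0] at this
      have := mul_nonneg hMa (le_max_right x₀ 0)
      linarith

end YoungFunction

/-- Positive real numbers. -/
abbrev Pos : Type := {a : ℝ // 0 < a}

/-! ### Nuclear Fréchet spaces with a scale of Hilbertian norms -/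

/-- An increasing sequence of Hilbertian norms `|·|_p` (given by inner products, conjugate linear
in the first variable) on a complex vector space `N`, together with a complex conjugation that
exhibits `N`, with its inner product of index `0`, as the complexification of a real inner product
space. -/
class HilbertianScale (N : Type*) [AddCommGroup N] [Module ℂ N] where
  core : ℕ → InnerProductSpace.Core ℂ N
  mono : ∀ p x, ((core p).inner x x).re ≤ ((core (p + 1)).inner x x).re
  conj : N →ₛₗ[starRingEnd ℂ] N
  conj_conj : ∀ x, conj (conj x) = x
  inner_conj : ∀ x y, (core 0).inner (conj x) (conj y) = starRingEnd ℂ ((core 0).inner x y)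

section Scale

/-- The space `N` with the norm `|·|_p`. -/
def PreLevel (N : Type*) (_p : ℕ) : Type _ := N

variable (N : Type*) [AddCommGroup N] [Module ℂ N] [HilbertianScale N]

instance (p : ℕ) : NormedAddCommGroup (PreLevel N p) :=
  @InnerProductSpace.Core.toNormedAddCommGroup ℂ N _ _ _ (HilbertianScale.core p)

instance (p : ℕ) : InnerProductSpace ℂ (PreLevel N p) :=
  InnerProductSpace.ofCore (F := N) (HilbertianScale.core (N := N) p).toCore

/-- The Hilbert space `(N)_p`: the completion of `N` for `|·|_p`. -/
def Level (p : ℕ) : Type _ := UniformSpace.Completion (PreLevel N p)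

instance (p : ℕ) : NormedAddCommGroup (Level N p) :=
  inferInstanceAs (NormedAddCommGroup (UniformSpace.Completion (PreLevel N p)))

instance (p : ℕ) : InnerProductSpace ℂ (Level N p) :=
  inferInstanceAs (InnerProductSpace ℂ (UniformSpace.Completion (PreLevel N p)))

instance (p : ℕ) : CompleteSpace (Level N p) :=
  inferInstanceAs (CompleteSpace (UniformSpace.Completion (PreLevel N p)))

/-- The Hilbert space `(N)_{-p}`: the dual of `(N)_p`, with the dual norm `|·|_{-p}`. -/
abbrev DualLevel (p : ℕ) : Type _ := StrongDual ℂ (Level N p)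

variable {N}

/-- The identity map from `N` to `(N, |·|_p)`. -/
def toPreLevel (p : ℕ) : N →ₗ[ℂ] PreLevel N p where
  toFun x := x
  map_add' _ _ := rfl
  map_smul' _ _ := rfl

/-- The norm `|·|_p` on `N`. -/
def levelNorm (p : ℕ) : Seminorm ℂ N := (normSeminorm ℂ (PreLevel N p)).comp (toPreLevel p)

theorem levelNorm_mono {p q : ℕ} (h : p ≤ q) (x : N) : levelNorm p x ≤ levelNorm q x := by
  have : Monotone fun p : ℕ => levelNorm p x :=
    monotone_nat_of_le_succ fun p => Real.sqrt_le_sqrt (HilbertianScale.mono p x)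
  exact this h

/-- The `ℂ`-bilinear form `⟨ξ, η⟩` on `N` that extends the real inner product of index `0`. -/
def bilin (ξ η : N) : ℂ :=
  (HilbertianScale.core (N := N) 0).inner (HilbertianScale.conj ξ) η

theorem bilin_add_left (a b c : N) : bilin (a + b) c = bilin a c + bilin b c := by
  rw [bilin, map_add]
  exact (HilbertianScale.core (N := N) 0).add_left _ _ _

theorem bilin_smul_left (r : ℂ) (a c : N) : bilin (r • a) c = r * bilin a c := by
  rw [bilin, LinearMap.map_smulₛₗ]
  refine ((HilbertianScale.core (N := N) 0).smul_left _ _ _).trans ?_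
  rw [Complex.conj_conj]
  rfl

theorem bilin_comm (a b : N) : bilin a b = bilin b a := by
  have h := HilbertianScale.inner_conj (HilbertianScale.conj a) b
  rw [HilbertianScale.conj_conj] at h
  rw [bilin, bilin,
    ← (HilbertianScale.core (N := N) 0).conj_inner_symm (HilbertianScale.conj b) a, h,
    Complex.conj_conj]

/-- The canonical isometry of `(N, |·|_p)` into its completion. -/
def coeLevel (p : ℕ) : PreLevel N p →ₗᵢ[ℂ] Level N p :=
  UniformSpace.Completion.toComplₗᵢ (𝕜 := ℂ) (E := PreLevel N p)

theorem denseRange_coeLevel (p : ℕ) : DenseRange (coeLevel (N := N) p) :=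
  UniformSpace.Completion.denseRange_coe

/-- The identity of `N` as a map from `(N, |·|_q)` to `(N, |·|_p)`, `p ≤ q`. -/
def preLink {p q : ℕ} (h : p ≤ q) : PreLevel N q →L[ℂ] PreLevel N p :=
  LinearMap.mkContinuous (σ := RingHom.id ℂ)
    { toFun := fun x => x, map_add' := fun _ _ => rfl, map_smul' := fun _ _ => rfl } 1
    fun x => (levelNorm_mono h (N := N) x).trans_eq (one_mul _).symm

/-- The canonical map `(N)_q → (N)_p`, `p ≤ q`. -/
def link {p q : ℕ} (h : p ≤ q) : Level N q →L[ℂ] Level N p :=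
  ((coeLevel p).toContinuousLinearMap.comp (preLink h)).extend (coeLevel q).toContinuousLinearMap

theorem link_coe {p q : ℕ} (h : p ≤ q) (x : PreLevel N q) :
    link h (coeLevel q x) = coeLevel p (preLink h x) :=
  ContinuousLinearMap.extend_eq _ (e := (coeLevel q).toContinuousLinearMap)
    (denseRange_coeLevel q) (coeLevel q).isometry.isUniformInducing x

theorem norm_link_le {p q : ℕ} (h : p ≤ q) (x : Level N q) : ‖link h x‖ ≤ ‖x‖ := by
  refine (denseRange_coeLevel q).induction_on x (isClosed_le (by fun_prop) (by fun_prop))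
    fun x => ?_
  rw [link_coe, LinearIsometry.norm_map, LinearIsometry.norm_map]
  exact levelNorm_mono h (N := N) x

/-- The canonical map `(N)_{-p} → (N)_{-q}`, `p ≤ q`. -/
def lift {p q : ℕ} (h : p ≤ q) : DualLevel N p →L[ℂ] DualLevel N q :=
  (ContinuousLinearMap.compL ℂ (Level N q) (Level N p) ℂ).flip (link h)

theorem norm_lift_le {p q : ℕ} (h : p ≤ q) (z : DualLevel N p) : ‖lift h z‖ ≤ ‖z‖ := by
  refine ContinuousLinearMap.opNorm_le_bound _ (norm_nonneg z) fun x => ?_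
  exact (z.le_opNorm _).trans (by gcongr; exact norm_link_le h x)

theorem weight_lift_le (θ : YoungFunction) {p q : ℕ} (h : p ≤ q) {a b : Pos} (hab : a ≤ b)
    (z : DualLevel N p) : θ (a * ‖lift h z‖) ≤ θ (b * ‖z‖) :=
  θ.mono (mul_nonneg a.2.le (norm_nonneg (lift h z)))
    (mul_le_mul hab (norm_lift_le h z) (norm_nonneg (lift h z)) b.2.le)

end Scale

/-- Hilbert–Schmidt operators: the squares of the norms of the images of the members of a Hilbert
basis are summable. -/
def IsHilbertSchmidt {E F : Type*} [NormedAddCommGroup E] [InnerProductSpace ℂ E]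
    [NormedAddCommGroup F] [InnerProductSpace ℂ F] (A : E →L[ℂ] F) : Prop :=
  ∃ (s : Set E) (b : HilbertBasis s ℂ E), Summable fun i => ‖A (b i)‖ ^ 2

/-- `N` is a complex nuclear Fréchet space, with topology defined by the increasing Hilbertian
norms of the scale: `N` is complete, and for every `p` some canonical map `(N)_q → (N)_p` is
Hilbert–Schmidt. -/
class IsNuclearFrechet (N : Type*) [AddCommGroup N] [Module ℂ N] [HilbertianScale N]
    [UniformSpace N] : Prop extends IsUniformAddGroup N, CompleteSpace N where
  withSeminorms : WithSeminorms (𝕜 := ℂ) (E := N)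
    fun p : ℕ => levelNorm p
  hilbertSchmidt : ∀ p : ℕ, ∃ (q : ℕ) (h : p ≤ q), IsHilbertSchmidt (link (N := N) h)


section Dual

variable {N : Type*} [AddCommGroup N] [Module ℂ N] [HilbertianScale N] [UniformSpace N]
  [IsNuclearFrechet N]

theorem continuous_toPreLevel (p : ℕ) : Continuous (toPreLevel (N := N) p) :=
  WithSeminorms.continuous_normedSpace_rng (PreLevel N p)
    (IsNuclearFrechet.withSeminorms (N := N)) _
    ⟨{p}, 1, by
      rw [one_smul, Finset.sup_singleton]
      exact le_rfl⟩

/-- The canonical map `N → (N)_p`. -/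
def toLevel (p : ℕ) : N →L[ℂ] Level N p :=
  (coeLevel p).toContinuousLinearMap.comp
    ⟨toPreLevel p, continuous_toPreLevel p⟩

/-- The canonical map `(N)_{-p} → N'`. -/
def toDual (p : ℕ) : DualLevel N p →ₗ[ℂ] StrongDual ℂ N where
  toFun z := z.comp (toLevel p)
  map_add' _ _ := rfl
  map_smul' _ _ := rfl

theorem toDual_apply (p : ℕ) (z : DualLevel N p) (ξ : N) : toDual p z ξ = z (toLevel p ξ) := rfl

theorem toDual_lift {p q : ℕ} (h : p ≤ q) (z : DualLevel N p) :
    toDual q (lift h z) = toDual p z := by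
  ext ξ
  exact congrArg z (link_coe h (toPreLevel q ξ))

theorem norm_toLevel (p : ℕ) (ξ : N) : ‖toLevel p ξ‖ = levelNorm p ξ :=
  (coeLevel p).norm_map (toPreLevel p ξ)

/-- `N'` is the union of the spaces `(N)_{-p}`. -/
theorem exists_toDual_eq (x : StrongDual ℂ N) : ∃ (p : ℕ) (z : DualLevel N p), toDual p z = x := by
  obtain ⟨s, C, -, hC⟩ := Seminorm.bound_of_continuous
    (IsNuclearFrechet.withSeminorms (N := N)) ((normSeminorm ℂ ℂ).comp x.toLinearMap)
    (continuous_norm.comp x.continuous)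
  have hb : ∀ ξ : N, ‖x ξ‖ ≤ C * levelNorm (s.sup id) ξ := fun ξ => by
    refine (hC ξ).trans ?_
    simp only [smul_apply, NNReal.smul_def, smul_eq_mul]
    gcongr
    refine Seminorm.finset_sup_apply_le (apply_nonneg _ _) fun p hp => ?_
    exact levelNorm_mono (Finset.le_sup (f := id) hp) ξ
  let y : PreLevel N (s.sup id) →L[ℂ] ℂ := LinearMap.mkContinuous (σ := RingHom.id ℂ)
    { toFun := fun ξ => x (show N from ξ)
      map_add' := fun a b => map_add x (show N from a) (show N from b)
      map_smul' := fun c a => map_smul x c (show N from a) } C fun ξ => hb ξ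
  refine ⟨s.sup id, y.extend (coeLevel (s.sup id)).toContinuousLinearMap, ?_⟩
  ext ξ
  exact ContinuousLinearMap.extend_eq y (e := (coeLevel (s.sup id)).toContinuousLinearMap)
    (denseRange_coeLevel _) (coeLevel _).isometry.isUniformInducing (toPreLevel _ ξ)

end Dual

/-! ### Entire functions of controlled growth -/

section Growth

variable {κ V : Type*} {E : κ → Type*} [∀ k, NormedAddCommGroup (E k)] [∀ k, NormedSpace ℂ (E k)]
  (ι : ∀ k, E k → V) (w : ∀ k, E k → ℝ)

/-- The functions on `V` whose pullbacks along all the maps `ι k : E k → V` are entire and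
`O(exp (w k))`. -/
def growthSubmodule : Submodule ℂ (V → ℂ) where
  carrier := {f | ∀ k, Differentiable ℂ (fun z => f (ι k z)) ∧
    ∃ C : ℝ, ∀ z, ‖f (ι k z)‖ ≤ C * Real.exp (w k z)}
  zero_mem' k := ⟨by simp, 0, by simp⟩
  add_mem' := by
    intro f g hf hg k
    obtain ⟨C, hC⟩ := (hf k).2
    obtain ⟨D, hD⟩ := (hg k).2
    refine ⟨(hf k).1.add (hg k).1, C + D, fun z => ?_⟩
    rw [add_mul]
    exact (norm_add_le _ _).trans (add_le_add (hC z) (hD z))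
  smul_mem' := by
    intro c f hf k
    obtain ⟨C, hC⟩ := (hf k).2
    refine ⟨(hf k).1.const_smul c, ‖c‖ * C, fun z => ?_⟩
    rw [mul_assoc, Pi.smul_apply, norm_smul]
    gcongr
    exact hC z

/-- The space of these functions, with the projective limit topology: the topology of the norms
`sup_z |f (ι k z)| exp (- w k z)`. -/
def Growth : Type _ := growthSubmodule ι w

instance : AddCommGroup (Growth ι w) := inferInstanceAs (AddCommGroup (growthSubmodule ι w))
instance : Module ℂ (Growth ι w) := inferInstanceAs (Module ℂ (growthSubmodule ι w))
instance : CoeFun (Growth ι w) (fun _ => V → ℂ) := ⟨Subtype.val⟩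

variable {ι w}

theorem Growth.ext {f g : Growth ι w} (h : ∀ x, f x = g x) : f = g := Subtype.ext (funext h)

theorem Growth.add_apply (f g : Growth ι w) (x : V) : (f + g) x = f x + g x := rfl

theorem Growth.smul_apply (c : ℂ) (f : Growth ι w) (x : V) : (c • f) x = c * f x := rfl

theorem Growth.differentiable (f : Growth ι w) (k : κ) : Differentiable ℂ (fun z => f (ι k z)) :=
  (f.2 k).1

theorem Growth.bddAbove (f : Growth ι w) (k : κ) :
    BddAbove (Set.range fun z => ‖f (ι k z)‖ * Real.exp (-w k z)) := by
  obtain ⟨C, hC⟩ := (f.2 k).2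
  refine ⟨C, ?_⟩
  rintro _ ⟨z, rfl⟩
  have := mul_le_mul_of_nonneg_right (hC z) (Real.exp_nonneg (-w k z))
  rwa [mul_assoc, ← Real.exp_add, add_neg_cancel, Real.exp_zero, mul_one] at this

variable (ι w)

/-- The norm `sup_z |f (ι k z)| exp (- w k z)`. -/
def growthNorm (k : κ) : Seminorm ℂ (Growth ι w) :=
  Seminorm.of (fun f => ⨆ z, ‖f (ι k z)‖ * Real.exp (-w k z))
    (fun f g => by
      refine ciSup_le fun z => ?_
      refine le_trans ?_ (add_le_add (le_ciSup (f.bddAbove k) z) (le_ciSup (g.bddAbove k) z))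
      rw [← add_mul, Growth.add_apply]
      gcongr
      exact norm_add_le _ _)
    (fun c f => by
      rw [Real.mul_iSup_of_nonneg (norm_nonneg c)]
      simp only [Growth.smul_apply, norm_mul, mul_assoc])

variable {ι w}

theorem Growth.norm_le (f : Growth ι w) (k : κ) (z : E k) :
    ‖f (ι k z)‖ ≤ growthNorm ι w k f * Real.exp (w k z) := by
  have := mul_le_mul_of_nonneg_right (le_ciSup (f.bddAbove k) z) (Real.exp_nonneg (w k z))
  rwa [mul_assoc, ← Real.exp_add, neg_add_cancel, Real.exp_zero, mul_one] at this

theorem growthNorm_le {f : Growth ι w} {k : κ} {C : ℝ}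
    (h : ∀ z, ‖f (ι k z)‖ ≤ C * Real.exp (w k z)) : growthNorm ι w k f ≤ C := by
  refine ciSup_le fun z => ?_
  have := mul_le_mul_of_nonneg_right (h z) (Real.exp_nonneg (-w k z))
  rwa [mul_assoc, ← Real.exp_add, add_neg_cancel, Real.exp_zero, mul_one] at this

instance : TopologicalSpace (Growth ι w) :=
  (SeminormFamily.moduleFilterBasis (growthNorm ι w)).topology

theorem growth_withSeminorms : WithSeminorms (growthNorm ι w) := ⟨rfl⟩

instance : IsTopologicalAddGroup (Growth ι w) := growth_withSeminorms.topologicalAddGroup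

instance : ContinuousSMul ℂ (Growth ι w) := growth_withSeminorms.continuousSMul

end Growth


/-! ### Auxiliary facts on entire functions on normed spaces -/

section Entire

variable {E : Type*} [NormedAddCommGroup E] [NormedSpace ℂ E]

theorem norm_fderiv_le_of_ball {f : E → ℂ} (hf : Differentiable ℂ f) {y : E} {C : ℝ}
    (hC : ∀ k, ‖k‖ ≤ 1 → ‖f (y + k)‖ ≤ C) : ‖fderiv ℂ f y‖ ≤ C := by
  have hC0 : 0 ≤ C := (norm_nonneg _).trans (hC 0 (by simp))
  refine ContinuousLinearMap.opNorm_le_of_unit_norm (𝕜 := ℂ) hC0 fun u hu => ?_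
  have hline : ∀ t : ℂ, HasDerivAt (fun t : ℂ => y + t • u) u t := fun t => by
    simpa using ((hasDerivAt_id t).smul_const u).const_add y
  have hd : HasDerivAt (fun t : ℂ => f (y + t • u)) (fderiv ℂ f y u) 0 := by
    have h1 : HasFDerivAt f (fderiv ℂ f y) (y + (0 : ℂ) • u) := by
      simpa using (hf y).hasFDerivAt
    exact h1.comp_hasDerivAt (0 : ℂ) (hline 0)
  rw [← hd.deriv]
  have hdiff : Differentiable ℂ (fun t : ℂ => f (y + t • u)) :=
    hf.comp fun t => (hline t).differentiableAt
  have := Complex.norm_deriv_le_of_forall_mem_sphere_norm_le (c := 0) (R := 1) (C := C) one_pos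
    hdiff.diffContOnCl fun t ht => hC _ (by
      rw [norm_smul, hu, mul_one]
      simpa using (mem_sphere_zero_iff_norm.1 ht).le)
  simpa using this

/-- Second order Taylor bound from a bound on a ball. -/
theorem norm_taylor_le_of_ball {f : E → ℂ} (hf : Differentiable ℂ f) {y : E} {C : ℝ}
    (hC : ∀ k, ‖k‖ ≤ 5 → ‖f (y + k)‖ ≤ C) {h : E} (hh : ‖h‖ ≤ 1) :
    ‖f (y + h) - f y - fderiv ℂ f y h‖ ≤ C * ‖h‖ * ‖h‖ := by
  have h1 : ∀ k, ‖k‖ ≤ 4 → ‖fderiv ℂ f (y + k)‖ ≤ C := fun k hk =>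
    norm_fderiv_le_of_ball hf fun l hl => by
      rw [add_assoc]
      exact hC _ ((norm_add_le _ _).trans (by linarith))
  have h2 : ∀ k l, ‖k‖ ≤ 2 → ‖l‖ ≤ 1 → ‖f (y + k + l) - f (y + k)‖ ≤ C * ‖l‖ := by
    intro k l hk hl
    have := (convex_ball (y + k) (1 + 1 / 2 : ℝ)).norm_image_sub_le_of_norm_fderiv_le (𝕜 := ℂ)
      (f := f) (C := C) (x := y + k) (y := y + k + l) (fun x _ => hf x) (fun x hx => by
        have e : x = y + (x - y) := by abel
        rw [e]
        refine h1 _ ?_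
        have e2 : x - y = (x - (y + k)) + k := by abel
        rw [Metric.mem_ball, dist_eq_norm] at hx
        rw [e2]
        exact (norm_add_le _ _).trans (by linarith)) (by simp; norm_num)
        (by rw [Metric.mem_ball, dist_eq_norm, add_sub_cancel_left]; linarith)
    simpa using this
  have h3 : ∀ l, ‖l‖ ≤ 1 → ‖fderiv ℂ f (y + l) - fderiv ℂ f y‖ ≤ C * ‖l‖ := by
    intro l hl
    have hd : ∀ x, HasFDerivAt (fun x => f (x + l) - f x) (fderiv ℂ f (x + l) - fderiv ℂ f x) x :=
      fun x => ((hasFDerivAt_comp_add_right l).2 (hf (x + l)).hasFDerivAt).sub (hf x).hasFDerivAt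
    rw [← (hd y).fderiv]
    exact norm_fderiv_le_of_ball (fun x => (hd x).differentiableAt) fun k hk =>
      h2 k l (hk.trans (by norm_num)) hl
  have hC0 : 0 ≤ C := (norm_nonneg _).trans (hC 0 (by simp))
  have := (convex_closedBall (0 : E) ‖h‖).norm_image_sub_le_of_norm_hasFDerivWithin_le (𝕜 := ℂ)
    (f := fun k => f (y + k) - fderiv ℂ f y k) (f' := fun k => fderiv ℂ f (y + k) - fderiv ℂ f y)
    (C := C * ‖h‖) (x := 0) (y := h)
    (fun k _ => (((hasFDerivAt_comp_add_left y).2 (hf (y + k)).hasFDerivAt).sub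
      (fderiv ℂ f y).hasFDerivAt).hasFDerivWithinAt)
    (fun k hk => by
      have hk' : ‖k‖ ≤ ‖h‖ := by simpa using hk
      exact (h3 k (hk'.trans hh)).trans (by gcongr)) (by simp) (by simp)
  simpa [sub_right_comm] using this

end Entire

/-- The Banach space of bounded functions on `E`. -/
abbrev BoundedFun (E : Type*) : Type _ := lp (fun _ : E => ℂ) ⊤

/-- The bounded function with given values, extended by `0` if there is no bound. -/
def mkBounded {E : Type*} (g : E → ℂ) (hg : ∃ C : ℝ, ∀ x, ‖g x‖ ≤ C) : BoundedFun E :=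
  ⟨g, memℓp_infty_iff.2 (by
    obtain ⟨C, hC⟩ := hg
    exact ⟨C, by rintro _ ⟨x, rfl⟩; exact hC x⟩)⟩

theorem norm_mkBounded_le {E : Type*} {g : E → ℂ} {C : ℝ} (hC0 : 0 ≤ C) (hC : ∀ x, ‖g x‖ ≤ C) :
    ‖mkBounded g ⟨C, hC⟩‖ ≤ C :=
  lp.norm_le_of_forall_le hC0 hC

section Translate

variable {E : Type*} [NormedAddCommGroup E] [NormedSpace ℂ E]

/-- Translates of an entire function depend holomorphically on the translation, in a weighted
supremum norm. -/
theorem differentiable_translate {f : E → ℂ} (hf : Differentiable ℂ f) {w : E → ℝ}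
    (hM : ∀ R : ℝ, ∃ M : ℝ, ∀ x z, ‖z‖ ≤ R → ‖f (x + z)‖ ≤ M * Real.exp (w x))
    (L : StrongDual ℂ (BoundedFun E)) (F : E → ℂ) (G : E → BoundedFun E)
    (hG : ∀ z x, G z x = f (x + z) * (Real.exp (-w x) : ℂ)) (hF : ∀ z, F z = L (G z)) :
    Differentiable ℂ F := by
  have hF' : F = fun z => L (G z) := funext hF
  rw [hF']
  refine L.differentiable.comp fun z => ?_
  obtain ⟨M, hM⟩ := hM (‖z‖ + 5)
  have hM0 : 0 ≤ M := by
    have := (norm_nonneg _).trans (hM 0 0 (by simp; positivity))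
    exact nonneg_of_mul_nonneg_left this (Real.exp_pos _)
  have key : ∀ (x k : E), ‖k‖ ≤ 5 → ‖f (x + z + k)‖ ≤ M * Real.exp (w x) := fun x k hk => by
    rw [add_assoc]
    exact hM x _ ((norm_add_le _ _).trans (by linarith))
  have hexp : ∀ (x : E) (a : ℂ) (B : ℝ), ‖a‖ ≤ M * Real.exp (w x) * B →
      ‖a * (Real.exp (-w x) : ℂ)‖ ≤ M * B := fun x a B h => by
    rw [norm_mul, Complex.norm_real, Real.norm_of_nonneg (Real.exp_nonneg _)]
    have := mul_le_mul_of_nonneg_right h (Real.exp_nonneg (-w x))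
    have e : M * Real.exp (w x) * B * Real.exp (-w x) = M * B := by
      rw [mul_right_comm (M * _), mul_assoc M, ← Real.exp_add]
      simp
    rwa [e] at this
  have hD : ∀ h x, ‖fderiv ℂ f (x + z) h * (Real.exp (-w x) : ℂ)‖ ≤ M * ‖h‖ := fun h x => by
    refine hexp x _ _ (((fderiv ℂ f (x + z)).le_opNorm h).trans ?_)
    gcongr
    exact norm_fderiv_le_of_ball hf fun k hk => key x k (hk.trans (by norm_num))
  let D : E →L[ℂ] BoundedFun E := LinearMap.mkContinuous
    { toFun := fun h => mkBounded (fun x => fderiv ℂ f (x + z) h * (Real.exp (-w x) : ℂ))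
        ⟨_, hD h⟩
      map_add' := fun a b => by
        ext x
        show fderiv ℂ f (x + z) (a + b) * _ = fderiv ℂ f (x + z) a * _ + fderiv ℂ f (x + z) b * _
        rw [map_add, add_mul]
      map_smul' := fun c a => by
        ext x
        show fderiv ℂ f (x + z) (c • a) * _ = c * (fderiv ℂ f (x + z) a * _)
        rw [map_smul, smul_eq_mul, mul_assoc] } M
    fun h => norm_mkBounded_le (mul_nonneg hM0 (norm_nonneg h)) (hD h)
  refine HasFDerivAt.differentiableAt (f' := D) ?_
  rw [hasFDerivAt_iff_isLittleO_nhds_zero]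
  refine Asymptotics.IsBigO.trans_isLittleO (g := fun h : E => ‖h‖ * ‖h‖) ?_ ?_
  · refine Asymptotics.IsBigO.of_bound M ?_
    filter_upwards [Metric.closedBall_mem_nhds (0 : E) one_pos] with h hh
    have hh' : ‖h‖ ≤ 1 := by simpa using hh
    refine lp.norm_le_of_forall_le (by positivity) fun x => ?_
    have e : (G (z + h) - G z - D h) x
        = (f (x + z + h) - f (x + z) - fderiv ℂ f (x + z) h) * (Real.exp (-w x) : ℂ) := by
      show G (z + h) x - G z x - fderiv ℂ f (x + z) h * (Real.exp (-w x) : ℂ) = _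
      rw [hG, hG, ← add_assoc]
      ring
    rw [e, Real.norm_of_nonneg (by positivity)]
    refine hexp x _ _ ((norm_taylor_le_of_ball hf (key x) hh').trans_eq (by ring))
  · have h1 : (fun h : E => ‖h‖) =o[𝓝 0] fun _ : E => (1 : ℝ) := by
      rw [Asymptotics.isLittleO_one_iff]
      simpa using (continuous_norm (E := E)).tendsto 0
    have h2 := h1.mul_isBigO (Asymptotics.isBigO_refl (fun h : E => ‖h‖) (𝓝 0))
    simp only [one_mul] at h2
    exact h2.of_norm_right

end Translate


/-- A bounded functional for one of the norms factors through the weighted bounded functions. -/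
theorem exists_factor_bounded {κ V : Type*} {E : κ → Type*} [∀ k, NormedAddCommGroup (E k)]
    [∀ k, NormedSpace ℂ (E k)] {ι : ∀ k, E k → V} {w : ∀ k, E k → ℝ} (k : κ)
    (Φ : Growth ι w →ₗ[ℂ] ℂ) {C : ℝ} (hC : ∀ f, ‖Φ f‖ ≤ C * growthNorm ι w k f) :
    ∃ (J : Growth ι w →ₗ[ℂ] BoundedFun (E k)) (L : StrongDual ℂ (BoundedFun (E k))),
      (∀ f x, J f x = f (ι k x) * (Real.exp (-w k x) : ℂ)) ∧ ∀ f, Φ f = L (J f) := by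
  have hb : ∀ (f : Growth ι w) (x : E k),
      ‖f (ι k x) * (Real.exp (-w k x) : ℂ)‖ = ‖f (ι k x)‖ * Real.exp (-w k x) := fun f x => by
    rw [norm_mul, Complex.norm_real, Real.norm_of_nonneg (Real.exp_nonneg _)]
  let J : Growth ι w →ₗ[ℂ] BoundedFun (E k) :=
    { toFun := fun f => mkBounded (fun x => f (ι k x) * (Real.exp (-w k x) : ℂ))
        ⟨growthNorm ι w k f, fun x => (hb f x).trans_le (le_ciSup (f.bddAbove k) x)⟩
      map_add' := fun f g => by
        ext x
        exact add_mul _ _ _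
      map_smul' := fun c f => by
        ext x
        exact mul_assoc _ _ _ }
  have hJ : ∀ f, growthNorm ι w k f ≤ ‖J f‖ := fun f =>
    ciSup_le fun x => (hb f x).symm.trans_le (lp.norm_apply_le_norm ENNReal.top_ne_zero (J f) x)
  have hJC : ∃ C : ℝ, ∀ f, ‖Φ f‖ ≤ C * ‖J f‖ := by
    refine ⟨max C 0, fun f => (hC f).trans ?_⟩
    calc C * growthNorm ι w k f ≤ max C 0 * growthNorm ι w k f :=
          mul_le_mul_of_nonneg_right (le_max_left _ _) (apply_nonneg _ _)
      _ ≤ max C 0 * ‖J f‖ := mul_le_mul_of_nonneg_left (hJ f) (le_max_right _ _)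
  obtain ⟨L, hL, -⟩ := exists_extension_norm_eq (𝕜 := ℂ) (LinearMap.range J) (Φ.compLeftInverse J)
  refine ⟨J, L, fun f x => rfl, fun f => ?_⟩
  rw [← LinearMap.compLeftInverse_apply_of_bdd Φ J hJC f (J f) rfl]
  exact (hL ⟨J f, f, rfl⟩).symm

/-! ### Test functions -/

section Spaces

variable (θ θ₁ θ₂ : YoungFunction) (N N₁ N₂ : Type*)
  [AddCommGroup N] [Module ℂ N] [HilbertianScale N] [UniformSpace N] [IsNuclearFrechet N]
  [AddCommGroup N₁] [Module ℂ N₁] [HilbertianScale N₁] [UniformSpace N₁] [IsNuclearFrechet N₁]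
  [AddCommGroup N₂] [Module ℂ N₂] [HilbertianScale N₂] [UniformSpace N₂] [IsNuclearFrechet N₂]

/-- The space `𝓕_θ(N')`: the functions on `N'` that are entire on every `(N)_{-p}` with
`|φ(z)| ≤ C exp θ(a |z|_{-p})` for all `a > 0`, with the projective limit topology. -/
abbrev TestSpace : Type _ :=
  Growth (κ := ℕ × Pos) (V := StrongDual ℂ N) (E := fun k => DualLevel N k.1)
    (fun k z => toDual k.1 z) (fun k z => θ (k.2 * ‖z‖))

/-- The space `𝓕_{(θ₁, θ₂)}(N₁' × N₂')`: the functions on `N₁' × N₂'` that are entire on every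
`(N₁)_{-p} × (N₂)_{-q}` with `|φ(z₁, z₂)| ≤ C exp (θ₁(a₁ |z₁|_{-p}) + θ₂(a₂ |z₂|_{-q}))` for all
`a₁, a₂ > 0`, with the projective limit topology. -/
abbrev TestSpace₂ : Type _ :=
  Growth (κ := (ℕ × ℕ) × (Pos × Pos)) (V := StrongDual ℂ N₁ × StrongDual ℂ N₂)
    (E := fun k => DualLevel N₁ k.1.1 × DualLevel N₂ k.1.2)
    (fun k z => (toDual k.1.1 z.1, toDual k.1.2 z.2))
    (fun k z => θ₁ (k.2.1 * ‖z.1‖) + θ₂ (k.2.2 * ‖z.2‖))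

/-- The space `𝓕*_{(θ₁, θ₂)}(N₁' × N₂')` of distributions on `N₁' × N₂'`. -/
abbrev Distribution₂ : Type _ := StrongDual ℂ (TestSpace₂ θ₁ θ₂ N₁ N₂)

/-- The space `𝓛(𝓕_θ₁(N₁'), 𝓕*_θ₂(N₂'))` of continuous linear operators; here `𝓕*_θ₂(N₂')` is the
dual of `𝓕_θ₂(N₂')` with the strong topology. -/
abbrev Operators : Type _ := TestSpace θ₁ N₁ →L[ℂ] StrongDual ℂ (TestSpace θ₂ N₂)

end Spaces

section Test

variable {θ θ₁ θ₂ : YoungFunction} {N N₁ N₂ : Type*}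
  [AddCommGroup N] [Module ℂ N] [HilbertianScale N] [UniformSpace N] [IsNuclearFrechet N]
  [AddCommGroup N₁] [Module ℂ N₁] [HilbertianScale N₁] [UniformSpace N₁] [IsNuclearFrechet N₁]
  [AddCommGroup N₂] [Module ℂ N₂] [HilbertianScale N₂] [UniformSpace N₂] [IsNuclearFrechet N₂]

/-- The norm of index `p, q, a₁, a₂` on `𝓕_{(θ₁, θ₂)}(N₁' × N₂')`. -/
abbrev testNorm₂ (k : (ℕ × ℕ) × (Pos × Pos)) : Seminorm ℂ (TestSpace₂ θ₁ θ₂ N₁ N₂) :=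
  growthNorm _ _ k

/-- The exponential function `e_ξ(z) = exp ⟨z, ξ⟩`. -/
def expVec (θ : YoungFunction) (ξ : N) : TestSpace θ N :=
  ⟨fun z => Complex.exp (z ξ), fun k => by
    refine ⟨?_, ?_⟩
    · exact Complex.differentiable_exp.comp
        (ContinuousLinearMap.apply ℂ ℂ (toLevel k.1 ξ)).differentiable
    · obtain ⟨C, hC⟩ := θ.exists_linear_le k.2.2 ‖toLevel k.1 ξ‖ (norm_nonneg _)
      refine ⟨Real.exp C, fun z => ?_⟩
      rw [Complex.norm_exp, ← Real.exp_add]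
      refine Real.exp_le_exp.2 (le_trans ?_ (hC ‖z‖ (norm_nonneg z)))
      refine (Complex.re_le_norm _).trans ((z.le_opNorm _).trans_eq (mul_comm _ _))⟩

/-- The function `(φ ⊗ ψ)(z₁, z₂) = φ(z₁) ψ(z₂)`. -/
def tensor (φ : TestSpace θ₁ N₁) (ψ : TestSpace θ₂ N₂) : TestSpace₂ θ₁ θ₂ N₁ N₂ :=
  ⟨fun z => φ z.1 * ψ z.2, fun k => by
    refine ⟨?_, ?_⟩
    · exact ((φ.differentiable (k.1.1, k.2.1)).comp differentiable_fst).mul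
        ((ψ.differentiable (k.1.2, k.2.2)).comp differentiable_snd)
    · refine ⟨growthNorm _ _ (k.1.1, k.2.1) φ * growthNorm _ _ (k.1.2, k.2.2) ψ, fun z => ?_⟩
      rw [norm_mul, Real.exp_add, mul_mul_mul_comm]
      exact mul_le_mul (φ.norm_le (k.1.1, k.2.1) z.1) (ψ.norm_le (k.1.2, k.2.2) z.2)
        (norm_nonneg _) (mul_nonneg (apply_nonneg _ _) (Real.exp_nonneg _))⟩

theorem testNorm₂_tensor_le (φ : TestSpace θ₁ N₁) (ψ : TestSpace θ₂ N₂)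
    (k : (ℕ × ℕ) × (Pos × Pos)) :
    testNorm₂ k (tensor φ ψ) ≤
      growthNorm _ _ (k.1.1, k.2.1) φ * growthNorm _ _ (k.1.2, k.2.2) ψ := by
  refine growthNorm_le fun z => ?_
  rw [Real.exp_add, mul_mul_mul_comm]
  refine (norm_mul _ _).trans_le ?_
  exact mul_le_mul (φ.norm_le (k.1.1, k.2.1) z.1) (ψ.norm_le (k.1.2, k.2.2) z.2)
    (norm_nonneg _) (mul_nonneg (apply_nonneg _ _) (Real.exp_nonneg _))

/-- The norms are directed. -/
theorem testNorm₂_mono {p p' q q' : ℕ} {a a' b b' : Pos} (hp : p ≤ p') (hq : q ≤ q')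
    (ha : a' ≤ a) (hb : b' ≤ b) (φ : TestSpace₂ θ₁ θ₂ N₁ N₂) :
    testNorm₂ ((p, q), (a, b)) φ ≤ testNorm₂ ((p', q'), (a', b')) φ := by
  refine growthNorm_le fun z => ?_
  have h := φ.norm_le ((p', q'), (a', b')) (lift hp z.1, lift hq z.2)
  simp only [toDual_lift] at h
  refine h.trans (mul_le_mul_of_nonneg_left (Real.exp_le_exp.2 ?_) (apply_nonneg _ _))
  exact add_le_add (weight_lift_le θ₁ hp ha z.1) (weight_lift_le θ₂ hq hb z.2)

theorem exists_testNorm₂_ge (s : Finset ((ℕ × ℕ) × (Pos × Pos))) :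
    ∃ k, ∀ i ∈ s, ∀ φ : TestSpace₂ θ₁ θ₂ N₁ N₂, testNorm₂ i φ ≤ testNorm₂ k φ := by
  induction s using Finset.induction_on with
  | empty => exact ⟨((0, 0), (⟨1, one_pos⟩, ⟨1, one_pos⟩)), by simp⟩
  | insert j s _ ih =>
    obtain ⟨k, hk⟩ := ih
    refine ⟨((max j.1.1 k.1.1, max j.1.2 k.1.2), (min j.2.1 k.2.1, min j.2.2 k.2.2)),
      fun i hi φ => ?_⟩
    rcases Finset.mem_insert.1 hi with rfl | hi
    · exact testNorm₂_mono (le_max_left _ _) (le_max_left _ _) (min_le_left _ _)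
        (min_le_left _ _) φ
    · exact (hk i hi φ).trans (testNorm₂_mono (le_max_right _ _) (le_max_right _ _)
        (min_le_right _ _) (min_le_right _ _) φ)

/-- A distribution is bounded for one of the norms. -/
theorem Distribution₂.exists_bound (Φ : Distribution₂ θ₁ θ₂ N₁ N₂) :
    ∃ k, ∃ C : ℝ, 0 ≤ C ∧ ∀ φ, ‖Φ φ‖ ≤ C * testNorm₂ k φ := by
  obtain ⟨s, C, -, hC⟩ := Seminorm.bound_of_continuous
    (growth_withSeminorms (ι := _) (w := _)) ((normSeminorm ℂ ℂ).comp Φ.toLinearMap)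
    (continuous_norm.comp Φ.continuous)
  obtain ⟨k, hk⟩ := exists_testNorm₂_ge (θ₁ := θ₁) (θ₂ := θ₂) (N₁ := N₁) (N₂ := N₂) s
  refine ⟨k, C, C.2, fun φ => (hC φ).trans ?_⟩
  simp only [smul_apply, NNReal.smul_def, smul_eq_mul]
  refine mul_le_mul_of_nonneg_left ?_ C.2
  exact Seminorm.finset_sup_apply_le (apply_nonneg _ _) fun i hi => hk i hi φ

/-- A linear functional bounded for one of the norms is a distribution. -/
def Distribution₂.ofBound (Φ : TestSpace₂ θ₁ θ₂ N₁ N₂ →ₗ[ℂ] ℂ)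
    (h : ∃ k, ∃ C : ℝ, ∀ φ, ‖Φ φ‖ ≤ C * testNorm₂ k φ) : Distribution₂ θ₁ θ₂ N₁ N₂ :=
  ⟨Φ, by
    obtain ⟨k, C, hC⟩ := h
    refine WithSeminorms.continuous_normedSpace_rng ℂ growth_withSeminorms Φ ⟨{k}, C.toNNReal, ?_⟩
    intro φ
    rw [Finset.sup_singleton]
    refine (hC φ).trans ?_
    exact mul_le_mul_of_nonneg_right (Real.le_coe_toNNReal C) (apply_nonneg _ _)⟩

/-- Half of the smaller of two scales. -/
def halfMin (a b : Pos) : Pos := ⟨min a.1 b.1 / 2, half_pos (lt_min a.2 b.2)⟩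

theorem two_mul_halfMin_le_left (a b : Pos) : 2 * (halfMin a b : ℝ) ≤ a :=
  (mul_div_cancel₀ _ two_ne_zero).trans_le (min_le_left _ _)

theorem two_mul_halfMin_le_right (a b : Pos) : 2 * (halfMin a b : ℝ) ≤ b :=
  (mul_div_cancel₀ _ two_ne_zero).trans_le (min_le_right _ _)

theorem norm_apply_add_le (φ : TestSpace₂ θ₁ θ₂ N₁ N₂) (p q : ℕ) (a₁ a₂ b₁ b₂ : Pos)
    (x z : DualLevel N₁ p × DualLevel N₂ q) :
    ‖φ (toDual p (x.1 + z.1), toDual q (x.2 + z.2))‖ ≤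
      testNorm₂ ((p, q), (halfMin a₁ b₁, halfMin a₂ b₂)) φ *
        Real.exp (θ₁ (b₁ * ‖z.1‖) + θ₂ (b₂ * ‖z.2‖)) *
        Real.exp (θ₁ (a₁ * ‖x.1‖) + θ₂ (a₂ * ‖x.2‖)) := by
  refine (φ.norm_le ((p, q), (halfMin a₁ b₁, halfMin a₂ b₂)) (x + z)).trans ?_
  rw [mul_assoc, ← Real.exp_add]
  refine mul_le_mul_of_nonneg_left (Real.exp_le_exp.2 ?_) (apply_nonneg _ _)
  have h₁ := θ₁.le_add (halfMin a₁ b₁).2.le (two_mul_halfMin_le_left a₁ b₁)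
    (two_mul_halfMin_le_right a₁ b₁) (norm_nonneg x.1) (norm_nonneg z.1) (norm_nonneg (x.1 + z.1))
    (norm_add_le x.1 z.1)
  have h₂ := θ₂.le_add (halfMin a₂ b₂).2.le (two_mul_halfMin_le_left a₂ b₂)
    (two_mul_halfMin_le_right a₂ b₂) (norm_nonneg x.2) (norm_nonneg z.2) (norm_nonneg (x.2 + z.2))
    (norm_add_le x.2 z.2)
  simp only [Prod.fst_add, Prod.snd_add]
  linarith

/-- The translate `τ_v φ(x) = φ(x + v)`. -/
def translate (v : StrongDual ℂ N₁ × StrongDual ℂ N₂) (φ : TestSpace₂ θ₁ θ₂ N₁ N₂) :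
    TestSpace₂ θ₁ θ₂ N₁ N₂ :=
  ⟨fun x => φ (x + v), fun k => by
    obtain ⟨⟨p, q⟩, a, b⟩ := k
    obtain ⟨v₁, v₂⟩ := v
    obtain ⟨m, y₁, rfl⟩ := exists_toDual_eq v₁
    obtain ⟨n, y₂, rfl⟩ := exists_toDual_eq v₂
    have e : ∀ x : DualLevel N₁ p × DualLevel N₂ q,
        ((toDual p x.1, toDual q x.2) + (toDual m y₁, toDual n y₂) :
          StrongDual ℂ N₁ × StrongDual ℂ N₂) =
        (toDual (max p m) (lift (le_max_left p m) x.1 + lift (le_max_right p m) y₁),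
          toDual (max q n) (lift (le_max_left q n) x.2 + lift (le_max_right q n) y₂)) := by
      intro x
      simp only [map_add, toDual_lift, Prod.mk_add_mk]
    simp only [e]
    refine ⟨?_, ?_⟩
    · refine (φ.differentiable ((max p m, max q n), (a, b))).comp
        (g := fun z => φ (toDual _ z.1, toDual _ z.2))
        (f := fun x : DualLevel N₁ p × DualLevel N₂ q =>
          (lift (le_max_left p m) x.1 + lift (le_max_right p m) y₁,
            lift (le_max_left q n) x.2 + lift (le_max_right q n) y₂)) ?_
      exact (((lift _).differentiable.comp differentiable_fst).add_const _).prodMk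
        (((lift _).differentiable.comp differentiable_snd).add_const _)
    · refine ⟨_, fun x => (norm_apply_add_le φ (max p m) (max q n) a b a b
        (lift (le_max_left p m) x.1, lift (le_max_left q n) x.2)
        (lift (le_max_right p m) y₁, lift (le_max_right q n) y₂)).trans
        (mul_le_mul_of_nonneg_left (Real.exp_le_exp.2 ?_)
          (mul_nonneg (apply_nonneg _ _) (Real.exp_nonneg _)))⟩
      exact add_le_add (weight_lift_le θ₁ _ le_rfl x.1) (weight_lift_le θ₂ _ le_rfl x.2)⟩

theorem testNorm₂_translate_le (φ : TestSpace₂ θ₁ θ₂ N₁ N₂) (p q : ℕ) (a₁ a₂ b₁ b₂ : Pos)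
    (z : DualLevel N₁ p × DualLevel N₂ q) :
    testNorm₂ ((p, q), (a₁, a₂)) (translate (toDual p z.1, toDual q z.2) φ) ≤
      testNorm₂ ((p, q), (halfMin a₁ b₁, halfMin a₂ b₂)) φ *
        Real.exp (θ₁ (b₁ * ‖z.1‖) + θ₂ (b₂ * ‖z.2‖)) := by
  refine growthNorm_le fun x => ?_
  have h := norm_apply_add_le φ p q a₁ a₂ b₁ b₂ x z
  rwa [map_add, map_add] at h

/-! ### Convolution -/

/-- A bound for a distribution holds at all high levels, for a fixed scale. -/
theorem norm_translate_le {Φ : Distribution₂ θ₁ θ₂ N₁ N₂} {m n : ℕ} {a₁ a₂ : Pos} {C : ℝ}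
    (hC0 : 0 ≤ C) (hC : ∀ φ, ‖Φ φ‖ ≤ C * testNorm₂ ((m, n), (a₁, a₂)) φ)
    (φ : TestSpace₂ θ₁ θ₂ N₁ N₂) (p q : ℕ) (b₁ b₂ : Pos)
    (z : DualLevel N₁ p × DualLevel N₂ q) :
    ‖Φ (translate (toDual p z.1, toDual q z.2) φ)‖ ≤
      C * testNorm₂ ((max p m, max q n), (halfMin a₁ b₁, halfMin a₂ b₂)) φ *
        Real.exp (θ₁ (b₁ * ‖z.1‖) + θ₂ (b₂ * ‖z.2‖)) := by
  refine (hC _).trans ?_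
  rw [mul_assoc]
  refine mul_le_mul_of_nonneg_left ?_ hC0
  refine (testNorm₂_mono (le_max_right p m) (le_max_right q n) le_rfl le_rfl _).trans ?_
  rw [← toDual_lift (le_max_left p m), ← toDual_lift (le_max_left q n)]
  refine (testNorm₂_translate_le φ (max p m) (max q n) a₁ a₂ b₁ b₂
    (lift (le_max_left p m) z.1, lift (le_max_left q n) z.2)).trans ?_
  refine mul_le_mul_of_nonneg_left (Real.exp_le_exp.2 ?_) (apply_nonneg _ _)
  exact add_le_add (weight_lift_le θ₁ _ le_rfl z.1) (weight_lift_le θ₂ _ le_rfl z.2)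

theorem differentiable_apply_translate (Φ : Distribution₂ θ₁ θ₂ N₁ N₂)
    (φ : TestSpace₂ θ₁ θ₂ N₁ N₂) (p q : ℕ) :
    Differentiable ℂ fun z : DualLevel N₁ p × DualLevel N₂ q =>
      Φ (translate (toDual p z.1, toDual q z.2) φ) := by
  obtain ⟨⟨⟨m, n⟩, a₁, a₂⟩, C, hC0, hC⟩ := Distribution₂.exists_bound Φ
  have hC' : ∀ φ, ‖Φ φ‖ ≤ C * testNorm₂ ((max p m, max q n), (a₁, a₂)) φ := fun φ =>
    (hC φ).trans (mul_le_mul_of_nonneg_left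
      (testNorm₂_mono (le_max_right p m) (le_max_right q n) le_rfl le_rfl φ) hC0)
  obtain ⟨J, L, hJ, hL⟩ := exists_factor_bounded _ Φ.toLinearMap hC'
  have key := differentiable_translate (φ.differentiable ((max p m, max q n), (a₁, a₂)))
    (w := fun x => θ₁ (a₁ * ‖x.1‖) + θ₂ (a₂ * ‖x.2‖)) (fun R => by
      refine ⟨testNorm₂ ((max p m, max q n), (halfMin a₁ a₁, halfMin a₂ a₂)) φ *
        Real.exp (θ₁ (a₁ * R) + θ₂ (a₂ * R)), fun x z hz => ?_⟩
      refine (norm_apply_add_le φ (max p m) (max q n) a₁ a₂ a₁ a₂ x z).trans ?_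
      refine mul_le_mul_of_nonneg_right (mul_le_mul_of_nonneg_left (Real.exp_le_exp.2 ?_)
        (apply_nonneg _ _)) (Real.exp_nonneg _)
      have h1 := (norm_fst_le z).trans hz
      have h2 := (norm_snd_le z).trans hz
      exact add_le_add
        (θ₁.mono (mul_nonneg a₁.2.le (norm_nonneg z.1)) (mul_le_mul_of_nonneg_left h1 a₁.2.le))
        (θ₂.mono (mul_nonneg a₂.2.le (norm_nonneg z.2)) (mul_le_mul_of_nonneg_left h2 a₂.2.le)))
    L (fun z => Φ (translate (toDual (max p m) z.1, toDual (max q n) z.2) φ))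
    (fun z => J (translate (toDual (max p m) z.1, toDual (max q n) z.2) φ))
    (fun z x => by
      rw [hJ]
      simp only [Prod.fst_add, Prod.snd_add, map_add]
      rfl)
    (fun z => hL _)
  have := key.comp (f := fun z : DualLevel N₁ p × DualLevel N₂ q =>
    (lift (le_max_left p m) z.1, lift (le_max_left q n) z.2))
    (((lift _).differentiable.comp differentiable_fst).prodMk
      ((lift _).differentiable.comp differentiable_snd))
  simpa only [Function.comp_def, toDual_lift] using this

/-- The convolution `(Φ ∗ φ)(z) = ⟨⟨Φ, τ_z φ⟩⟩` of a distribution with a test function. -/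
def convTest (Φ : Distribution₂ θ₁ θ₂ N₁ N₂) (φ : TestSpace₂ θ₁ θ₂ N₁ N₂) :
    TestSpace₂ θ₁ θ₂ N₁ N₂ :=
  ⟨fun z => Φ (translate z φ), fun k => by
    refine ⟨differentiable_apply_translate Φ φ k.1.1 k.1.2, ?_⟩
    obtain ⟨⟨⟨m, n⟩, a₁, a₂⟩, C, hC0, hC⟩ := Distribution₂.exists_bound Φ
    exact ⟨_, norm_translate_le hC0 hC φ k.1.1 k.1.2 k.2.1 k.2.2⟩⟩

/-- The convolution of two distributions: `⟨⟨Ψ ∗ Φ, φ⟩⟩ = ⟨⟨Ψ, Φ ∗ φ⟩⟩`. -/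
def conv (Ψ Φ : Distribution₂ θ₁ θ₂ N₁ N₂) : Distribution₂ θ₁ θ₂ N₁ N₂ :=
  Distribution₂.ofBound
    { toFun := fun φ => Ψ (convTest Φ φ)
      map_add' := fun φ ψ => by
        rw [← map_add]
        exact congrArg Ψ (Growth.ext fun z => map_add Φ (translate z φ) (translate z ψ))
      map_smul' := fun c φ => by
        rw [RingHom.id_apply, ← map_smul]
        exact congrArg Ψ (Growth.ext fun z => map_smul Φ c (translate z φ)) } (by
    obtain ⟨⟨⟨p, q⟩, b₁, b₂⟩, D, hD0, hD⟩ := Distribution₂.exists_bound Ψ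
    obtain ⟨⟨⟨m, n⟩, a₁, a₂⟩, C, hC0, hC⟩ := Distribution₂.exists_bound Φ
    refine ⟨((max p m, max q n), (halfMin a₁ b₁, halfMin a₂ b₂)), D * C, fun φ => (hD _).trans ?_⟩
    rw [mul_assoc]
    exact mul_le_mul_of_nonneg_left
      (growthNorm_le (norm_translate_le hC0 hC φ p q b₁ b₂)) hD0)

end Test

/-! ### Kernels and symbols of operators -/

section Operators

variable {θ₁ θ₂ : YoungFunction} {N₁ N₂ : Type*}
  [AddCommGroup N₁] [Module ℂ N₁] [HilbertianScale N₁] [UniformSpace N₁] [IsNuclearFrechet N₁]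
  [AddCommGroup N₂] [Module ℂ N₂] [HilbertianScale N₂] [UniformSpace N₂] [IsNuclearFrechet N₂]

/-- `K` is the kernel of `Ξ`: `⟨⟨Ξ φ, ψ⟩⟩ = ⟨⟨K, φ ⊗ ψ⟩⟩` for all `φ`, `ψ`. -/
def IsKernel (Ξ : Operators θ₁ θ₂ N₁ N₂) (K : Distribution₂ θ₁ θ₂ N₁ N₂) : Prop :=
  ∀ φ ψ, Ξ φ ψ = K (tensor φ ψ)

open Classical in
/-- The kernel `Ξ^K` of an operator `Ξ`. (By the kernel theorem it always exists; the value `0`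
serves only to make the definition total.) -/
def kernel (Ξ : Operators θ₁ θ₂ N₁ N₂) : Distribution₂ θ₁ θ₂ N₁ N₂ :=
  if h : ∃ K, IsKernel Ξ K then h.choose else 0

/-- The functional `ψ ↦ ⟨⟨K, φ ⊗ ψ⟩⟩`. -/
def slice (K : Distribution₂ θ₁ θ₂ N₁ N₂) (φ : TestSpace θ₁ N₁) : StrongDual ℂ (TestSpace θ₂ N₂) :=
  ⟨{ toFun := fun ψ => K (tensor φ ψ)
     map_add' := fun f g => by
      rw [← map_add]
      exact congrArg K (Growth.ext fun z => mul_add _ _ _)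
     map_smul' := fun c f => by
      rw [RingHom.id_apply, ← map_smul]
      exact congrArg K (Growth.ext fun z => mul_left_comm _ _ _) }, by
    obtain ⟨k, C, hC0, hC⟩ := Distribution₂.exists_bound K
    refine WithSeminorms.continuous_normedSpace_rng ℂ growth_withSeminorms _
      ⟨{(k.1.2, k.2.2)}, (C * growthNorm _ _ (k.1.1, k.2.1) φ).toNNReal, fun ψ => ?_⟩
    rw [Finset.sup_singleton]
    refine ((hC _).trans (mul_le_mul_of_nonneg_left (testNorm₂_tensor_le φ ψ k) hC0)).trans ?_
    rw [← mul_assoc]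
    exact mul_le_mul_of_nonneg_right (Real.le_coe_toNNReal _) (apply_nonneg _ _)⟩

/-- `slice` as a linear map. -/
def sliceLinear (K : Distribution₂ θ₁ θ₂ N₁ N₂) :
    TestSpace θ₁ N₁ →ₗ[ℂ] StrongDual ℂ (TestSpace θ₂ N₂) where
  toFun := slice K
  map_add' f g := by
    ext ψ
    refine Eq.trans ?_ (map_add K (tensor f ψ) (tensor g ψ))
    exact congrArg K (Growth.ext fun z => add_mul _ _ _)
  map_smul' c f := by
    ext ψ
    refine Eq.trans ?_ (map_smul K c (tensor f ψ))
    exact congrArg K (Growth.ext fun z => mul_assoc _ _ _)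

/-- The operator with kernel `K`: `⟨⟨Ξ φ, ψ⟩⟩ = ⟨⟨K, φ ⊗ ψ⟩⟩`. -/
def ofKernel (K : Distribution₂ θ₁ θ₂ N₁ N₂) : Operators θ₁ θ₂ N₁ N₂ :=
  ⟨sliceLinear K, by
    obtain ⟨k, C, hC0, hC⟩ := Distribution₂.exists_bound K
    refine continuous_of_continuousAt_zero (sliceLinear K) ?_
    rw [ContinuousAt, map_zero,
      (ContinuousLinearMap.hasBasis_nhds_zero_of_basis Metric.nhds_basis_ball).tendsto_right_iff]
    rintro ⟨S, r⟩ ⟨hS, hr⟩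
    obtain ⟨M, hM0, hM⟩ := (growth_withSeminorms.isVonNBounded_iff_seminorm_bounded).1 hS
      (k.1.2, k.2.2)
    have hcont : Tendsto (fun φ : TestSpace θ₁ N₁ => C * (growthNorm _ _ (k.1.1, k.2.1) φ * M))
        (𝓝 0) (𝓝 (C * (growthNorm _ _ (k.1.1, k.2.1) (0 : TestSpace θ₁ N₁) * M))) :=
      (((growth_withSeminorms.continuous_seminorm (k.1.1, k.2.1)).mul_const M).const_mul C).tendsto 0
    rw [map_zero, zero_mul, mul_zero] at hcont
    filter_upwards [hcont.eventually (gt_mem_nhds hr)] with φ hφ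
    intro ψ hψ
    rw [mem_ball_zero_iff]
    refine lt_of_le_of_lt ((hC _).trans (mul_le_mul_of_nonneg_left ?_ hC0)) hφ
    refine (testNorm₂_tensor_le φ ψ k).trans ?_
    exact mul_le_mul_of_nonneg_left (hM ψ hψ).le (apply_nonneg _ _)⟩

theorem isKernel_ofKernel (K : Distribution₂ θ₁ θ₂ N₁ N₂) : IsKernel (ofKernel K) K :=
  fun _ _ => rfl

/-- The symbol `σ(Ξ)(ξ₁, ξ₂) = ⟨⟨Ξ e_ξ₁, e_ξ₂⟩⟩`. -/
def symbol (Ξ : Operators θ₁ θ₂ N₁ N₂) (ξ₁ : N₁) (ξ₂ : N₂) : ℂ :=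
  Ξ (expVec θ₁ ξ₁) (expVec θ₂ ξ₂)

end Operators

/-! ### The trace functional -/

section Trace

variable (N : Type*) [AddCommGroup N] [Module ℂ N] [HilbertianScale N] [UniformSpace N]
  [IsNuclearFrechet N]

/-- `(N)_0` as a real Hilbert space, with inner product `Re ⟨x, y⟩`. -/
instance : InnerProductSpace ℝ (Level N 0) := InnerProductSpace.complexToReal

/-- The real Hilbert space whose complexification is `(N)_0`: the closure of the real elements of
`N` in `(N)_0`. -/
def realPart : Submodule ℝ (Level N 0) :=
  (Submodule.span ℝ (toLevel 0 '' {ξ : N | HilbertianScale.conj ξ = ξ})).topologicalClosure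

instance : CompleteSpace (realPart N) :=
  inferInstanceAs (CompleteSpace (Submodule.topologicalClosure _))

/-- The index set of `traceBasis`. -/
def traceIndex : Set (realPart N) := (exists_hilbertBasis ℝ (realPart N)).choose

/-- A complete orthonormal basis `(e_j)` of `(N)_0` consisting of real elements. -/
def traceBasis : HilbertBasis (traceIndex N) ℝ (realPart N) :=
  (exists_hilbertBasis ℝ (realPart N)).choose_spec.choose

/-- The basis element `e_j` as the member `⟨e_j, ·⟩` of `(N)_{-0}`. -/
def traceVec (j : traceIndex N) : DualLevel N 0 := innerSL ℂ (traceBasis N j : Level N 0)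

variable {N}

/-- The trace functional `τ`, applied to an element of the second symmetric tensor power of `N`
that is given as the quadratic form `Q(x) = ⟨x ⊗ x, w⟩` on `N'`: the sum over `j` of
`⟨e_j ⊗ e_j, w⟩`. -/
def traceForm (Q : StrongDual ℂ N → ℂ) : ℂ := ∑' j, Q (toDual 0 (traceVec N j))

theorem orthonormal_traceBasis :
    Orthonormal ℝ fun j => (traceBasis N j : Level N 0) :=
  (traceBasis N).orthonormal.comp_linearIsometry (realPart N).subtypeₗᵢ

theorem sum_norm_inner_sq_le (J : Finset (traceIndex N)) (x : Level N 0) :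
    ∑ j ∈ J, ‖traceVec N j x‖ ^ 2 ≤ 2 * ‖x‖ ^ 2 := by
  have h1 := orthonormal_traceBasis.sum_inner_products_le (𝕜 := ℝ) x (s := J)
  have h2 := orthonormal_traceBasis.sum_inner_products_le (𝕜 := ℝ) (-Complex.I • x) (s := J)
  rw [norm_smul, norm_neg, Complex.norm_I, one_mul] at h2
  rw [two_mul]
  refine le_trans (le_of_eq ?_) (add_le_add h1 h2)
  rw [← Finset.sum_add_distrib]
  refine Finset.sum_congr rfl fun j _ => ?_
  have e : traceVec N j x = inner ℂ (traceBasis N j : Level N 0) x := rfl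
  have e1 : inner ℝ (traceBasis N j : Level N 0) x
      = (inner ℂ (traceBasis N j : Level N 0) x : ℂ).re := rfl
  have e2 : inner ℝ (traceBasis N j : Level N 0) (-Complex.I • x)
      = (inner ℂ (traceBasis N j : Level N 0) x : ℂ).im := by
    have : inner ℝ (traceBasis N j : Level N 0) (-Complex.I • x)
      = (inner ℂ (traceBasis N j : Level N 0) (-Complex.I • x) : ℂ).re := rfl
    rw [this, inner_smul_right]
    simp
  rw [e, e1, e2, Complex.sq_norm, Complex.normSq_apply, Real.norm_eq_abs, Real.norm_eq_abs,
    sq_abs, sq_abs]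
  ring

theorem norm_sq_eq_tsum {E : Type*} [NormedAddCommGroup E] [InnerProductSpace ℂ E]
    [CompleteSpace E] {s : Set E} (b : HilbertBasis s ℂ E) (l : StrongDual ℂ E) :
    HasSum (fun i => ‖l (b i)‖ ^ 2) (‖l‖ ^ 2) := by
  obtain ⟨r, rfl⟩ := (InnerProductSpace.toDual ℂ E).surjective l
  have h := (b.hasSum_inner_mul_inner r r).mapL Complex.reCLM
  have e : Complex.reCLM (inner ℂ r r) = ‖(InnerProductSpace.toDual ℂ E) r‖ ^ 2 := by
    rw [LinearIsometryEquiv.norm_map]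
    exact (norm_sq_eq_re_inner (𝕜 := ℂ) r).symm
  rw [e] at h
  convert h using 2 with i
  rw [InnerProductSpace.toDual_apply_apply, ← inner_conj_symm (b i) r, Complex.mul_conj,
    Complex.reCLM_apply, Complex.ofReal_re, Complex.normSq_eq_norm_sq]

/-- The embedding of `(N)_0` into some `(N)_{-p}` is Hilbert–Schmidt. -/
theorem exists_summable_norm_lift :
    ∃ p : ℕ, Summable fun j => ‖lift (Nat.zero_le p) (traceVec N j)‖ ^ 2 := by
  obtain ⟨p, h, s, b, hb⟩ := IsNuclearFrechet.hilbertSchmidt (N := N) 0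
  refine ⟨p, summable_of_sum_le (c := 2 * ∑' i, ‖link h (b i)‖ ^ 2) (fun j => by positivity)
    fun J => ?_⟩
  have h1 : HasSum (fun i => ∑ j ∈ J, ‖lift (Nat.zero_le p) (traceVec N j) (b i)‖ ^ 2)
      (∑ j ∈ J, ‖lift (Nat.zero_le p) (traceVec N j)‖ ^ 2) :=
    hasSum_sum fun j _ => norm_sq_eq_tsum b _
  exact hasSum_le (fun i => sum_norm_inner_sq_le J (link h (b i))) h1 (hb.hasSum.mul_left 2)

theorem exists_trace_bound : ∃ (p : ℕ) (S : ℝ), 0 ≤ S ∧ ∀ (Q : StrongDual ℂ N → ℂ) (A : ℝ),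
    (∀ v : DualLevel N p, ‖Q (toDual p v)‖ ≤ A * ‖v‖ ^ 2) →
      Summable (fun j => Q (toDual 0 (traceVec N j))) ∧ ‖traceForm Q‖ ≤ A * S := by
  obtain ⟨p, hp⟩ := exists_summable_norm_lift (N := N)
  refine ⟨p, ∑' j, ‖lift (Nat.zero_le p) (traceVec N j)‖ ^ 2,
    tsum_nonneg fun j => by positivity, fun Q A hQ => ?_⟩
  have hb : ∀ j, ‖Q (toDual 0 (traceVec N j))‖ ≤
      A * ‖lift (Nat.zero_le p) (traceVec N j)‖ ^ 2 := fun j => by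
    rw [← toDual_lift (Nat.zero_le p)]
    exact hQ _
  exact ⟨Summable.of_norm_bounded (hp.mul_left A) hb,
    tsum_of_norm_bounded (hp.hasSum.mul_left A) hb⟩



theorem inner_toLevel (ξ η : N) : inner ℂ (toLevel 0 ξ) (toLevel 0 η) =
    (HilbertianScale.core (N := N) 0).inner ξ η :=
  (coeLevel 0).inner_map_map (toPreLevel 0 ξ) (toPreLevel 0 η)

/-- Inner products of elements of the real part are real. -/
theorem inner_realPart_im {x y : Level N 0} (hx : x ∈ realPart N) (hy : y ∈ realPart N) :
    (inner ℂ x y : ℂ).im = 0 := by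
  have key : ∀ a b : N, HilbertianScale.conj a = a → HilbertianScale.conj b = b →
      (inner ℂ (toLevel 0 a) (toLevel 0 b) : ℂ).im = 0 := fun a b ha hb => by
    have := HilbertianScale.inner_conj a b
    rw [ha, hb] at this
    rw [inner_toLevel]
    exact Complex.conj_eq_iff_im.1 this.symm
  have step : ∀ y : Level N 0, ∀ T : Set (Level N 0),
      (∀ t ∈ T, (inner ℂ y t : ℂ).im = 0) →
      ∀ z ∈ (Submodule.span ℝ T).topologicalClosure, (inner ℂ y z : ℂ).im = 0 := by
    intro y T hT
    let A : Level N 0 →L[ℝ] ℝ := Complex.imCLM.comp ((innerSL ℂ y).restrictScalars ℝ)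
    have hle : (Submodule.span ℝ T).topologicalClosure ≤ LinearMap.ker A.toLinearMap :=
      Submodule.topologicalClosure_minimal _ (Submodule.span_le.2 hT) A.isClosed_ker
    exact fun z hz => hle hz
  have swap : ∀ u v : Level N 0, (inner ℂ u v : ℂ).im = 0 → (inner ℂ v u : ℂ).im = 0 := by
    intro u v h
    rw [← inner_conj_symm, Complex.conj_im, h, neg_zero]
  refine step x _ ?_ y hy
  rintro _ ⟨b, hb, rfl⟩
  refine swap _ _ (step _ _ ?_ x hx)
  rintro _ ⟨a, ha, rfl⟩
  exact key b a hb ha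

theorem toLevel_mem_realPart {ξ : N} (h : HilbertianScale.conj ξ = ξ) :
    toLevel 0 ξ ∈ realPart N :=
  Submodule.le_topologicalClosure _ (Submodule.subset_span ⟨ξ, h, rfl⟩)

theorem inner_eq_real {x y : Level N 0} (hx : x ∈ realPart N) (hy : y ∈ realPart N) :
    inner ℂ x y = ((inner ℝ (⟨x, hx⟩ : realPart N) ⟨y, hy⟩ : ℝ) : ℂ) :=
  Complex.ext rfl (by rw [inner_realPart_im hx hy, Complex.ofReal_im])

theorem hasSum_trace_real {a b : N} (ha : HilbertianScale.conj a = a)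
    (hb : HilbertianScale.conj b = b) :
    HasSum (fun j => toDual 0 (traceVec N j) a * toDual 0 (traceVec N j) b) (bilin a b) := by
  have ha' := toLevel_mem_realPart ha
  have hb' := toLevel_mem_realPart hb
  have h := (traceBasis N).hasSum_inner_mul_inner (⟨_, ha'⟩ : realPart N) ⟨_, hb'⟩
  have h2 := h.mapL Complex.ofRealCLM
  have e : Complex.ofRealCLM (inner ℝ (⟨_, ha'⟩ : realPart N) ⟨_, hb'⟩) = bilin a b := by
    rw [bilin, ha, ← inner_toLevel, inner_eq_real ha' hb']
    rfl
  rw [e] at h2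
  refine h2.congr_fun ?_
  intro j
  have e1 : ∀ (c : N) (hc : toLevel 0 c ∈ realPart N), toDual 0 (traceVec N j) c =
      ((inner ℝ (traceBasis N j) (⟨_, hc⟩ : realPart N) : ℝ) : ℂ) := fun c hc =>
    inner_eq_real (traceBasis N j).2 hc
  rw [e1 a ha', e1 b hb', real_inner_comm, ← Complex.ofReal_mul]
  rfl

/-- `⟨τ, ξ ⊗ η⟩ = ⟨ξ, η⟩`. -/
theorem traceForm_tensor (ξ η : N) :
    HasSum (fun j => toDual 0 (traceVec N j) ξ * toDual 0 (traceVec N j) η) (bilin ξ η) := by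
  have dec : ∀ ζ : N, ∃ a b : N, HilbertianScale.conj a = a ∧ HilbertianScale.conj b = b ∧
      ζ = a + Complex.I • b := by
    intro ζ
    refine ⟨(1 / 2 : ℂ) • (ζ + HilbertianScale.conj ζ),
      (-Complex.I / 2) • (ζ - HilbertianScale.conj ζ), ?_, ?_, ?_⟩
    · rw [LinearMap.map_smulₛₗ, map_add, HilbertianScale.conj_conj, add_comm]
      simp only [map_div₀, map_one, map_ofNat]
    · rw [LinearMap.map_smulₛₗ, map_sub, HilbertianScale.conj_conj, ← neg_sub ζ, smul_neg,
        ← neg_smul]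
      simp only [map_div₀, map_neg, Complex.conj_I, map_ofNat, neg_neg, neg_div]
    · rw [smul_smul, show Complex.I * (-Complex.I / 2) = 1 / 2 by
        rw [mul_div_assoc', mul_neg, Complex.I_mul_I, neg_neg], ← smul_add]
      rw [show ζ + HilbertianScale.conj ζ + (ζ - HilbertianScale.conj ζ) = (2 : ℂ) • ζ by
        rw [two_smul]; abel, smul_smul]
      norm_num
  obtain ⟨a, b, ha, hb, rfl⟩ := dec ξ
  obtain ⟨c, d, hc, hd, rfl⟩ := dec η
  have h := ((hasSum_trace_real ha hc).add ((hasSum_trace_real ha hd).mul_left Complex.I)).add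
    (((hasSum_trace_real hb hc).mul_left Complex.I).add
      ((hasSum_trace_real hb hd).mul_left (Complex.I * Complex.I)))
  convert h using 1
  · funext j
    simp only [map_add, map_smul, smul_eq_mul]
    ring
  · rw [bilin_add_left, bilin_smul_left, bilin_comm a, bilin_comm b, bilin_add_left,
      bilin_smul_left, bilin_add_left, bilin_smul_left, bilin_comm c a, bilin_comm d a,
      bilin_comm c b, bilin_comm d b]
    ring

end Trace

/-! ### The quantum Gross Laplacian -/

section Gross

variable {θ₁ θ₂ : YoungFunction} {N₁ N₂ : Type*}
  [AddCommGroup N₁] [Module ℂ N₁] [HilbertianScale N₁] [UniformSpace N₁] [IsNuclearFrechet N₁]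
  [AddCommGroup N₂] [Module ℂ N₂] [HilbertianScale N₂] [UniformSpace N₂] [IsNuclearFrechet N₂]

theorem norm_secondDeriv_le {g : ℂ → ℂ} (hg : Differentiable ℂ g) {M r : ℝ} (hr : 0 ≤ r)
    (h0 : r = 0 → ∀ t, g t = g 0) (hM : ∀ t : ℂ, ‖t‖ * r ≤ 1 → ‖g t‖ ≤ M) :
    ‖2⁻¹ * iteratedDeriv 2 g 0‖ ≤ M * r ^ 2 := by
  rcases hr.eq_or_lt with h | h
  · have e : g = fun _ => g 0 := funext (h0 h.symm)
    rw [e, ← h]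
    simp [iteratedDeriv_const]
  · have := Complex.norm_iteratedDeriv_le_of_forall_mem_sphere_norm_le (c := 0) (R := r⁻¹) (C := M)
      2 (inv_pos.2 h) hg.diffContOnCl (fun t ht => hM t (by
        rw [mem_sphere_zero_iff_norm.1 ht, inv_mul_cancel₀ h.ne']))
    rw [norm_mul]
    calc ‖(2⁻¹ : ℂ)‖ * ‖iteratedDeriv 2 g 0‖
        ≤ ‖(2⁻¹ : ℂ)‖ * (Nat.factorial 2 * M / r⁻¹ ^ 2) := by gcongr
      _ = M * r ^ 2 := by
        simp [Nat.factorial]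
        field_simp

/-- The Taylor coefficient `φ_{2,0}` as a quadratic form: `⟨x ⊗ x, φ_{2,0}⟩` is the coefficient of
`t²` in `φ(t x, 0)`. -/
def coeff₂₀ (φ : TestSpace₂ θ₁ θ₂ N₁ N₂) (x : StrongDual ℂ N₁) : ℂ :=
  2⁻¹ * iteratedDeriv 2 (fun t : ℂ => φ (t • x, 0)) 0

/-- The Taylor coefficient `φ_{0,2}` as a quadratic form: `⟨y ⊗ y, φ_{0,2}⟩` is the coefficient of
`t²` in `φ(0, t y)`. -/
def coeff₀₂ (φ : TestSpace₂ θ₁ θ₂ N₁ N₂) (y : StrongDual ℂ N₂) : ℂ :=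
  2⁻¹ * iteratedDeriv 2 (fun t : ℂ => φ (0, t • y)) 0

theorem differentiable_line (φ : TestSpace₂ θ₁ θ₂ N₁ N₂) (x : StrongDual ℂ N₁)
    (y : StrongDual ℂ N₂) : Differentiable ℂ fun t : ℂ => φ (t • x, t • y) := by
  obtain ⟨p, u, rfl⟩ := exists_toDual_eq x
  obtain ⟨q, v, rfl⟩ := exists_toDual_eq y
  have := (φ.differentiable ((p, q), (⟨1, one_pos⟩, ⟨1, one_pos⟩))).comp
    (f := fun t : ℂ => (t • u, t • v))
    ((differentiable_id.smul_const u).prodMk (differentiable_id.smul_const v))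
  simpa only [Function.comp_def, map_smul] using this

theorem differentiable_line_left (φ : TestSpace₂ θ₁ θ₂ N₁ N₂) (x : StrongDual ℂ N₁) :
    Differentiable ℂ fun t : ℂ => φ (t • x, 0) := by
  have h := differentiable_line φ x 0
  have e : ∀ t : ℂ, t • (0 : StrongDual ℂ N₂) = 0 := fun t =>
    smul_zero (A := StrongDual ℂ N₂) t
  simp only [e] at h
  exact h

theorem differentiable_line_right (φ : TestSpace₂ θ₁ θ₂ N₁ N₂) (y : StrongDual ℂ N₂) :
    Differentiable ℂ fun t : ℂ => φ (0, t • y) := by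
  have h := differentiable_line φ 0 y
  have e : ∀ t : ℂ, t • (0 : StrongDual ℂ N₁) = 0 := fun t =>
    smul_zero (A := StrongDual ℂ N₁) t
  simp only [e] at h
  exact h

theorem coeff₂₀_add (φ ψ : TestSpace₂ θ₁ θ₂ N₁ N₂) (x : StrongDual ℂ N₁) :
    coeff₂₀ (φ + ψ) x = coeff₂₀ φ x + coeff₂₀ ψ x := by
  rw [coeff₂₀, coeff₂₀, coeff₂₀, ← mul_add,
    ← iteratedDeriv_add (differentiable_line_left φ x).contDiff.contDiffAt
      (differentiable_line_left ψ x).contDiff.contDiffAt]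
  rfl

theorem coeff₀₂_add (φ ψ : TestSpace₂ θ₁ θ₂ N₁ N₂) (y : StrongDual ℂ N₂) :
    coeff₀₂ (φ + ψ) y = coeff₀₂ φ y + coeff₀₂ ψ y := by
  rw [coeff₀₂, coeff₀₂, coeff₀₂, ← mul_add,
    ← iteratedDeriv_add (differentiable_line_right φ y).contDiff.contDiffAt
      (differentiable_line_right ψ y).contDiff.contDiffAt]
  rfl

theorem coeff₂₀_smul (c : ℂ) (φ : TestSpace₂ θ₁ θ₂ N₁ N₂) (x : StrongDual ℂ N₁) :
    coeff₂₀ (c • φ) x = c * coeff₂₀ φ x := by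
  rw [coeff₂₀, coeff₂₀, mul_left_comm,
    ← iteratedDeriv_const_mul_field c (fun t : ℂ => φ (t • x, 0))]
  rfl

theorem coeff₀₂_smul (c : ℂ) (φ : TestSpace₂ θ₁ θ₂ N₁ N₂) (y : StrongDual ℂ N₂) :
    coeff₀₂ (c • φ) y = c * coeff₀₂ φ y := by
  rw [coeff₀₂, coeff₀₂, mul_left_comm,
    ← iteratedDeriv_const_mul_field c (fun t : ℂ => φ (0, t • y))]
  rfl

theorem norm_coeff₂₀_le (φ : TestSpace₂ θ₁ θ₂ N₁ N₂) (p : ℕ) (u : DualLevel N₁ p) :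
    ‖coeff₂₀ φ (toDual p u)‖ ≤
      testNorm₂ ((p, 0), (⟨1, one_pos⟩, ⟨1, one_pos⟩)) φ * Real.exp (θ₁ 1) * ‖u‖ ^ 2 := by
  refine norm_secondDeriv_le (differentiable_line_left φ _) (norm_nonneg u)
    (fun h t => by
      have e : ∀ s : ℂ, s • toDual p u = 0 := fun s => by
        rw [show u = 0 from norm_eq_zero.1 h, map_zero]
        exact smul_zero (A := StrongDual ℂ N₁) s
      exact congrArg (fun x => φ (x, 0)) ((e t).trans (e 0).symm))
    fun t ht => ?_
  have h := φ.norm_le ((p, 0), (⟨1, one_pos⟩, ⟨1, one_pos⟩)) (t • u, 0)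
  simp only [map_smul, map_zero, norm_zero, mul_zero, one_mul] at h
  rw [θ₂.map_zero, add_zero] at h
  refine h.trans (mul_le_mul_of_nonneg_left (Real.exp_le_exp.2 ?_) (apply_nonneg _ _))
  exact θ₁.mono (norm_nonneg (t • u)) ((norm_smul t u).trans_le ht)

theorem norm_coeff₀₂_le (φ : TestSpace₂ θ₁ θ₂ N₁ N₂) (p : ℕ) (u : DualLevel N₂ p) :
    ‖coeff₀₂ φ (toDual p u)‖ ≤
      testNorm₂ ((0, p), (⟨1, one_pos⟩, ⟨1, one_pos⟩)) φ * Real.exp (θ₂ 1) * ‖u‖ ^ 2 := by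
  refine norm_secondDeriv_le (differentiable_line_right φ _) (norm_nonneg u)
    (fun h t => by
      have e : ∀ s : ℂ, s • toDual p u = 0 := fun s => by
        rw [show u = 0 from norm_eq_zero.1 h, map_zero]
        exact smul_zero (A := StrongDual ℂ N₂) s
      exact congrArg (fun x => φ (0, x)) ((e t).trans (e 0).symm))
    fun t ht => ?_
  have h := φ.norm_le ((0, p), (⟨1, one_pos⟩, ⟨1, one_pos⟩)) (0, t • u)
  simp only [map_smul, map_zero, norm_zero, mul_zero, one_mul] at h
  rw [θ₁.map_zero, zero_add] at h
  refine h.trans (mul_le_mul_of_nonneg_left (Real.exp_le_exp.2 ?_) (apply_nonneg _ _))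
  exact θ₂.mono (norm_nonneg (t • u)) ((norm_smul t u).trans_le ht)

theorem summable_coeff₂₀ (φ : TestSpace₂ θ₁ θ₂ N₁ N₂) :
    Summable fun j => coeff₂₀ φ (toDual 0 (traceVec N₁ j)) := by
  obtain ⟨p, S, -, h⟩ := exists_trace_bound (N := N₁)
  exact (h _ _ (norm_coeff₂₀_le φ p)).1

theorem summable_coeff₀₂ (φ : TestSpace₂ θ₁ θ₂ N₁ N₂) :
    Summable fun j => coeff₀₂ φ (toDual 0 (traceVec N₂ j)) := by
  obtain ⟨p, S, -, h⟩ := exists_trace_bound (N := N₂)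
  exact (h _ _ (norm_coeff₀₂_le φ p)).1

/-- The distribution `𝒯` with Taylor coefficients `𝒯_{2,0} = τ₁`, `𝒯_{0,2} = τ₂` and
`𝒯_{n,m} = 0` otherwise. Since the pairing of a distribution with a test function is
`⟨⟨Φ, φ⟩⟩ = ∑ n! m! ⟨Φ_{n,m}, φ_{n,m}⟩`, it is
`⟨⟨𝒯, φ⟩⟩ = 2! ⟨τ₁, φ_{2,0}⟩ + 2! ⟨τ₂, φ_{0,2}⟩`. -/
def traceDistribution : Distribution₂ θ₁ θ₂ N₁ N₂ :=
  Distribution₂.ofBound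
    { toFun := fun φ => 2 * traceForm (coeff₂₀ φ) + 2 * traceForm (coeff₀₂ φ)
      map_add' := fun φ ψ => by
        have h₁ : traceForm (coeff₂₀ (φ + ψ)) = traceForm (coeff₂₀ φ) + traceForm (coeff₂₀ ψ) := by
          simp only [traceForm, coeff₂₀_add]
          exact (summable_coeff₂₀ φ).tsum_add (summable_coeff₂₀ ψ)
        have h₂ : traceForm (coeff₀₂ (φ + ψ)) = traceForm (coeff₀₂ φ) + traceForm (coeff₀₂ ψ) := by
          simp only [traceForm, coeff₀₂_add]
          exact (summable_coeff₀₂ φ).tsum_add (summable_coeff₀₂ ψ)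
        rw [h₁, h₂]
        ring
      map_smul' := fun c φ => by
        have h₁ : traceForm (coeff₂₀ (c • φ)) = c * traceForm (coeff₂₀ φ) := by
          simp only [traceForm, coeff₂₀_smul, tsum_mul_left]
        have h₂ : traceForm (coeff₀₂ (c • φ)) = c * traceForm (coeff₀₂ φ) := by
          simp only [traceForm, coeff₀₂_smul, tsum_mul_left]
        rw [h₁, h₂, RingHom.id_apply, smul_eq_mul]
        ring } (by
    obtain ⟨p, S, S0, hS⟩ := exists_trace_bound (N := N₁)
    obtain ⟨q, T, T0, hT⟩ := exists_trace_bound (N := N₂)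
    obtain ⟨k, hk⟩ := exists_testNorm₂_ge (θ₁ := θ₁) (θ₂ := θ₂) (N₁ := N₁) (N₂ := N₂)
      {((p, 0), (⟨1, one_pos⟩, ⟨1, one_pos⟩)), ((0, q), (⟨1, one_pos⟩, ⟨1, one_pos⟩))}
    refine ⟨k, 2 * (Real.exp (θ₁ 1) * S) + 2 * (Real.exp (θ₂ 1) * T), fun φ => ?_⟩
    have h₁ : ‖traceForm (coeff₂₀ φ)‖ ≤ testNorm₂ k φ * (Real.exp (θ₁ 1) * S) := by
      refine (hS _ _ (norm_coeff₂₀_le φ p)).2.trans ?_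
      rw [mul_assoc]
      exact mul_le_mul_of_nonneg_right (hk _ (Finset.mem_insert_self _ _) φ)
        (mul_nonneg (Real.exp_nonneg _) S0)
    have h₂ : ‖traceForm (coeff₀₂ φ)‖ ≤ testNorm₂ k φ * (Real.exp (θ₂ 1) * T) := by
      refine (hT _ _ (norm_coeff₀₂_le φ q)).2.trans ?_
      rw [mul_assoc]
      exact mul_le_mul_of_nonneg_right
        (hk _ (Finset.mem_insert_of_mem (Finset.mem_singleton_self _)) φ)
        (mul_nonneg (Real.exp_nonneg _) T0)
    have h2 : ‖(2 : ℂ)‖ = 2 := by simp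
    refine (norm_add_le _ _).trans ?_
    rw [norm_mul, norm_mul, h2]
    linarith)

/-- The quantum Gross Laplacian `Δ_G^Q(Ξ) = 𝒯 ∗ Ξ^K`, an operator being identified with its
kernel: `Δ_G^Q(Ξ)` is the operator with kernel `𝒯 ∗ Ξ^K`. -/
def quantumGrossLaplacian (Ξ : Operators θ₁ θ₂ N₁ N₂) : Operators θ₁ θ₂ N₁ N₂ :=
  ofKernel (conv traceDistribution (kernel Ξ))

end Gross

end WhiteNoise

end

open WhiteNoise

/-!
The symbol of `Δ_G^Q(Ξ)` is `⟨⟨𝒯 ∗ Ξ^K, e_ξ₁ ⊗ e_ξ₂⟩⟩ = ⟨⟨𝒯, Ξ^K ∗ (e_ξ₁ ⊗ e_ξ₂)⟩⟩`. Translation multiplies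
an exponential function by a scalar, so that `K ∗ (e_ξ₁ ⊗ e_ξ₂) = ⟨⟨K, e_ξ₁ ⊗ e_ξ₂⟩⟩ e_ξ₁ ⊗ e_ξ₂` for
every distribution `K` (`convTest_tensor_expVec`). The second Taylor coefficients of the
exponential function are `(ξ₁ ⊗ ξ₁) / 2` and `(ξ₂ ⊗ ξ₂) / 2`, whence
`⟨⟨𝒯, e_ξ₁ ⊗ e_ξ₂⟩⟩ = ⟨ξ₁, ξ₁⟩ + ⟨ξ₂, ξ₂⟩` (`traceDistribution_tensor_expVec`).

This uses that `Ξ^K` really is a kernel of `Ξ`, and most of the proof is the kernel theorem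
`exists_isKernel`. Continuity of `Ξ` into the strong dual bounds the bilinear form `⟨⟨Ξ φ, ψ⟩⟩` by a
pair of norms (`Operators.exists_bound`). A composition of two Hilbert–Schmidt embeddings of the
scale gives a nuclear series `z = ∑ ⟨z, ξ_i⟩ h_i` for `z` in a given `(N₂)_{-q}`, convergent in some
larger `(N₂)_{-r}` (`exists_nuclear_lift`). Inserting it in the Taylor series in the second variable
expands a test function as
`f(x, z) = ∑ (1 / n!) (∂_{h_{i_1}} ⋯ ∂_{h_{i_n}} f)(x, 0) ⟨z, ξ_{i_1}⟩ ⋯ ⟨z, ξ_{i_n}⟩`,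
over all `n` and all `i_1, …, i_n`. Cauchy's estimates on a ball whose radius is proportional to `|z|`
show that the series converges absolutely in the weighted norms: the growth of `f` is then offset
exactly by the weight at `z`, whatever the Young function is, and there remains a geometric series
(`exists_nuclear_expansion`). The kernel is obtained by applying the bilinear form to this
expansion term by term.

The derivatives `∂_h` are convolution operators, so they preserve the space of test functions, and
only one-variable complex analysis on lines is needed.
-/

noncomputable section

namespace WhiteNoise

universe u

open Filter Topology Complex

/-! ### Joint continuity of the bilinear form of an operator -/

section Bilinear

variable {θ θ₁ θ₂ : YoungFunction} {N N₁ N₂ : Type*}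
  [AddCommGroup N] [Module ℂ N] [HilbertianScale N] [UniformSpace N] [IsNuclearFrechet N]
  [AddCommGroup N₁] [Module ℂ N₁] [HilbertianScale N₁] [UniformSpace N₁] [IsNuclearFrechet N₁]
  [AddCommGroup N₂] [Module ℂ N₂] [HilbertianScale N₂] [UniformSpace N₂] [IsNuclearFrechet N₂]

/-- The norm of index `p, a` on `𝓕_θ(N')`. -/
abbrev testNorm (k : ℕ × Pos) : Seminorm ℂ (TestSpace θ N) :=
  growthNorm _ _ k

theorem testNorm_mono {p p' : ℕ} {a a' : Pos} (hp : p ≤ p') (ha : a' ≤ a) (φ : TestSpace θ N) :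
    testNorm (p, a) φ ≤ testNorm (p', a') φ := by
  refine growthNorm_le fun z => ?_
  have h := φ.norm_le (p', a') (lift hp z)
  simp only [toDual_lift] at h
  exact h.trans (mul_le_mul_of_nonneg_left
    (Real.exp_le_exp.2 (weight_lift_le θ hp ha z)) (apply_nonneg _ _))

/-- The indices of a countable cofinal family of norms on `𝓕_θ(N')`. -/
def diagIndex (n : ℕ) : ℕ × Pos := (n, ⟨1 / ((n : ℝ) + 1), Nat.one_div_pos_of_nat⟩)

theorem tendsto_zero_of_diag {φ : ℕ → TestSpace θ N}
    (h : ∀ n : ℕ, testNorm (diagIndex n) (φ n) < 1 / ((n : ℝ) + 1)) :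
    Tendsto φ atTop (𝓝 0) := by
  rw [growth_withSeminorms.tendsto_nhds]
  rintro ⟨p, a⟩ ε hε
  have h0 := tendsto_one_div_add_atTop_nhds_zero_nat (𝕜 := ℝ)
  filter_upwards [h0.eventually (gt_mem_nhds hε), h0.eventually (gt_mem_nhds a.2),
    eventually_ge_atTop p] with n h1 h2 h3
  rw [sub_zero]
  exact (testNorm_mono h3 (Subtype.coe_le_coe.1 h2.le) (φ n)).trans_lt ((h n).trans h1)

theorem seminorm_smul_lt {E : Type*} [AddCommGroup E] [Module ℂ E] (P : Seminorm ℂ E) (x : E)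
    {c t : ℝ} (hc : 0 < c) (ht : 0 < t) : P ((((c * (P x + t))⁻¹ : ℝ) : ℂ) • x) < 1 / c := by
  have h0 : 0 ≤ P x := apply_nonneg _ _
  rw [map_smul_eq_mul, Complex.norm_real, Real.norm_of_nonneg (by positivity), mul_inv,
    mul_assoc, one_div]
  refine mul_lt_of_lt_one_right (inv_pos.2 hc) ?_
  rw [inv_mul_lt_iff₀ (by positivity)]
  linarith

/-- Continuity into the strong dual gives joint sequential continuity at the origin, since a null
sequence is bounded; as the test spaces are metrizable, it gives a bound for a pair of norms. -/
theorem Operators.exists_bound (Ξ : Operators θ₁ θ₂ N₁ N₂) : ∃ (k l : ℕ × Pos) (C : ℝ), 0 ≤ C ∧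
    ∀ φ ψ, ‖Ξ φ ψ‖ ≤ C * testNorm k φ * testNorm l ψ := by
  have key : ∃ n : ℕ, ∀ φ ψ, testNorm (diagIndex n) φ < 1 / ((n : ℝ) + 1) →
      testNorm (diagIndex n) ψ < 1 / ((n : ℝ) + 1) → ‖Ξ φ ψ‖ ≤ 1 := by
    by_contra! hcon
    choose φ ψ hφ hψ h using hcon
    have hψ0 := tendsto_zero_of_diag hψ
    have hb : Bornology.IsVonNBounded ℂ (Set.range ψ) := by
      let := IsTopologicalAddGroup.rightUniformSpace (TestSpace θ₂ N₂)
      have := isUniformAddGroup_of_addCommGroup (G := TestSpace θ₂ N₂)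
      exact hψ0.isVonNBounded_range ℂ
    have hΞ : Tendsto (fun n => Ξ (φ n)) atTop (𝓝 0) := by
      have := (Ξ.continuous.tendsto 0).comp (tendsto_zero_of_diag hφ)
      rwa [map_zero] at this
    have h1 := ((ContinuousLinearMap.hasBasis_nhds_zero_of_basis
      (Metric.nhds_basis_ball (x := (0 : ℂ)))).tendsto_right_iff.1 hΞ)
      (Set.range ψ, 1) ⟨hb, one_pos⟩
    obtain ⟨n, hn⟩ := h1.exists
    have h2 := hn (ψ n) ⟨n, rfl⟩
    rw [mem_ball_zero_iff] at h2
    exact (h n).not_gt h2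
  obtain ⟨n, hn⟩ := key
  refine ⟨diagIndex n, diagIndex n, ((n : ℝ) + 1) ^ 2, by positivity, fun φ ψ => ?_⟩
  have hn0 : (0 : ℝ) < n + 1 := by positivity
  have hbound : ∀ t : ℝ, 0 < t → ‖Ξ φ ψ‖ ≤ ((n : ℝ) + 1) ^ 2 *
      (testNorm (diagIndex n) φ + t) * (testNorm (diagIndex n) ψ + t) := by
    intro t ht
    have h0 : 0 ≤ testNorm (diagIndex n) φ := apply_nonneg _ _
    have h0' : 0 ≤ testNorm (diagIndex n) ψ := apply_nonneg _ _
    have h := hn _ _ (seminorm_smul_lt _ φ hn0 ht) (seminorm_smul_lt _ ψ hn0 ht)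
    rw [map_smul, map_smul, smul_apply, smul_eq_mul, smul_eq_mul, norm_mul,
      norm_mul, Complex.norm_real, Complex.norm_real, Real.norm_of_nonneg (by positivity),
      Real.norm_of_nonneg (by positivity), ← mul_assoc, ← mul_inv,
      inv_mul_le_iff₀ (by positivity)] at h
    linarith
  have hlim : Tendsto (fun t : ℝ => ((n : ℝ) + 1) ^ 2 *
      (testNorm (diagIndex n) φ + t) * (testNorm (diagIndex n) ψ + t)) (𝓝[>] 0)
      (𝓝 (((n : ℝ) + 1) ^ 2 * (testNorm (diagIndex n) φ + 0) *
        (testNorm (diagIndex n) ψ + 0))) :=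
    Continuous.tendsto' (by fun_prop) _ _ rfl |>.mono_left nhdsWithin_le_nhds
  simp only [add_zero] at hlim
  exact ge_of_tendsto hlim (eventually_mem_nhdsWithin.mono fun t ht => hbound t ht)

end Bilinear

/-! ### Nuclearity of the scale -/

section Nuclear

variable {N : Type*} [AddCommGroup N] [Module ℂ N] [HilbertianScale N] [UniformSpace N]
  [IsNuclearFrechet N]

/-- Every element of a completion `(N)_p` is the sum of a series of elements of `N` that converges
absolutely, with control of the sum of the norms. -/
theorem exists_series_toLevel (p : ℕ) (x : Level N p) : ∃ ξ : ℕ → N,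
    (∀ k, ‖toLevel p (ξ k)‖ ≤ ‖x‖ * (4 * (1 / 2) ^ k)) ∧
      HasSum (fun k => toLevel p (ξ k)) x := by
  rcases eq_or_ne x 0 with rfl | hx
  · exact ⟨0, fun k => by simp, by simp⟩
  have hx0 : 0 < ‖x‖ := norm_pos_iff.2 hx
  have hmem : x ∈ closure ((LinearMap.range (toLevel (N := N) p).toLinearMap).toAddSubgroup :
      Set (Level N p)) := denseRange_coeLevel p x
  obtain ⟨v, hv, hv1, hv2, hv3⟩ := controlled_sum_of_mem_closure hmem
    (b := fun k => ‖x‖ * (1 / 2) ^ k) (fun k => by positivity)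
  choose ξ hξ using hv1
  have hb : ∀ k, ‖v k‖ ≤ ‖x‖ * (4 * (1 / 2) ^ k) := by
    intro k
    rcases k.eq_zero_or_pos with rfl | hk
    · have : v 0 = x - (-v 0 + x) := by abel
      rw [this]
      refine (norm_sub_le _ _).trans ?_
      simp only [pow_zero, mul_one] at hv2 ⊢
      linarith
    · refine (hv3 k hk).le.trans (mul_le_mul_of_nonneg_left ?_ hx0.le)
      have : (0 : ℝ) ≤ (1 / 2) ^ k := by positivity
      linarith
  have e : ∀ k, toLevel p (ξ k) = v k := hξ
  refine ⟨ξ, fun k => by rw [e]; exact hb k, ?_⟩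
  simp only [e]
  have hs : Summable v := Summable.of_norm_bounded
    ((summable_geometric_two.mul_left 4).mul_left ‖x‖) hb
  have := hs.hasSum.tendsto_sum_nat.comp (tendsto_add_atTop_nat 1)
  rw [← tendsto_nhds_unique this hv]
  exact hs.hasSum

theorem link_toLevel {p q : ℕ} (h : p ≤ q) (ξ : N) :
    link h (toLevel q ξ) = toLevel p ξ :=
  link_coe h (toPreLevel q ξ)

/-- The adjoint of a Hilbert–Schmidt operator sends every Hilbert basis of dual vectors to a
square summable family. -/
theorem summable_norm_comp_sq {E F : Type*} [NormedAddCommGroup E] [InnerProductSpace ℂ E]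
    [CompleteSpace E] [NormedAddCommGroup F] [InnerProductSpace ℂ F] {A : E →L[ℂ] F}
    (hA : IsHilbertSchmidt A) {s : Set F} (b : HilbertBasis s ℂ F) :
    Summable fun i => ‖(innerSL ℂ (b i)).comp A‖ ^ 2 := by
  obtain ⟨t, c, hc⟩ := hA
  refine summable_of_sum_le (c := ∑' k, ‖A (c k)‖ ^ 2) (fun j => by positivity) fun J => ?_
  have h1 : HasSum (fun k => ∑ j ∈ J, ‖(innerSL ℂ (b j)).comp A (c k)‖ ^ 2)
      (∑ j ∈ J, ‖(innerSL ℂ (b j)).comp A‖ ^ 2) :=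
    hasSum_sum fun j _ => norm_sq_eq_tsum c _
  exact hasSum_le (fun k => b.orthonormal.sum_inner_products_le (A (c k))) h1 hc.hasSum

/-- Some embedding `(N)_{-p} → (N)_{-q}` is nuclear, with a representing series whose functionals
on `(N)_{-p}` are given by elements of `N`. -/
theorem exists_nuclear_lift (N : Type u) [AddCommGroup N] [Module ℂ N] [HilbertianScale N]
    [UniformSpace N] [IsNuclearFrechet N] (p : ℕ) :
    ∃ (q : ℕ) (hpq : p ≤ q) (I : Type u) (ξ : I → N) (h : I → DualLevel N q),
      Summable (fun i => ‖toLevel p (ξ i)‖ * ‖h i‖) ∧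
        ∀ z : DualLevel N p, HasSum (fun i => z (toLevel p (ξ i)) • h i) (lift hpq z) := by
  obtain ⟨r, hpr, s, b, hb⟩ := IsNuclearFrechet.hilbertSchmidt (N := N) p
  obtain ⟨q, hrq, hHS⟩ := IsNuclearFrechet.hilbertSchmidt (N := N) r
  choose ξ hξ hξs using fun j => exists_series_toLevel p (link hpr (b j))
  let h : s → DualLevel N q := fun j => (innerSL ℂ (b j)).comp (link hrq)
  have hh : Summable fun j => ‖h j‖ ^ 2 := summable_norm_comp_sq hHS b
  have hmul : Summable fun j => ‖link hpr (b j)‖ * ‖h j‖ := by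
    refine Summable.of_nonneg_of_le (fun j => by positivity) (fun j => ?_) (hb.add hh)
    nlinarith [sq_nonneg (‖link hpr (b j)‖ - ‖h j‖), sq_nonneg ‖link hpr (b j)‖, sq_nonneg ‖h j‖]
  have hsum : Summable fun i : s × ℕ => ‖toLevel p (ξ i.1 i.2)‖ * ‖h i.1‖ := by
    refine Summable.of_nonneg_of_le (fun i => by positivity) (fun i => ?_)
      (hmul.mul_of_nonneg (summable_geometric_two.mul_left 4) (fun j => by positivity)
        (fun k => by positivity))
    exact (mul_le_mul_of_nonneg_right (hξ i.1 i.2) (norm_nonneg _)).trans_eq (by ring)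
  refine ⟨q, hpr.trans hrq, s × ℕ, fun i => ξ i.1 i.2, fun i => h i.1, hsum, fun z => ?_⟩
  have hs : Summable fun i : s × ℕ => z (toLevel p (ξ i.1 i.2)) • h i.1 := by
    refine Summable.of_norm_bounded (hsum.mul_left ‖z‖) fun i => ?_
    rw [norm_smul, ← mul_assoc]
    exact mul_le_mul_of_nonneg_right (z.le_opNorm _) (norm_nonneg _)
  have link_link : ∀ η : N, link hpr (link hrq (toLevel q η)) =
      link (hpr.trans hrq) (toLevel q η) := fun η => by
    rw [link_toLevel, link_toLevel, link_toLevel]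
  have e : ∑' i : s × ℕ, z (toLevel p (ξ i.1 i.2)) • h i.1 = lift (hpr.trans hrq) z := by
    refine ContinuousLinearMap.ext fun y => ?_
    refine congrFun ((denseRange_coeLevel q).equalizer (ContinuousLinearMap.continuous _)
      (ContinuousLinearMap.continuous _) (funext fun η => ?_)) y
    have h1 := (hs.hasSum.mapL (ContinuousLinearMap.apply ℂ ℂ (coeLevel q η))).prod_fiberwise
      fun j => ((hξs j).mapL z).mul_right (h j (coeLevel q η))
    have h2 := (b.hasSum_repr (link hrq (coeLevel q η))).mapL (z.comp (link hpr))
    have h3 := h1.unique (h2.congr_fun fun j => ?_)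
    · refine h3.trans ?_
      exact congrArg z (link_link η)
    · rw [map_smul, b.repr_apply_apply, smul_eq_mul, mul_comm]
      rfl
  rw [← e]
  exact hs.hasSum

end Nuclear

/-! ### Directional derivatives of test functions in the second variable -/

section Deriv

variable {θ₁ θ₂ : YoungFunction} {N₁ N₂ : Type*}
  [AddCommGroup N₁] [Module ℂ N₁] [HilbertianScale N₁] [UniformSpace N₁] [IsNuclearFrechet N₁]
  [AddCommGroup N₂] [Module ℂ N₂] [HilbertianScale N₂] [UniformSpace N₂] [IsNuclearFrechet N₂]

/-- The restriction of a test function to a slice `{x} × (N₂)_{-q}` is entire. -/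
theorem differentiable_snd_slice (f : TestSpace₂ θ₁ θ₂ N₁ N₂) (x : StrongDual ℂ N₁) (q : ℕ) :
    Differentiable ℂ fun w : DualLevel N₂ q => f (x, toDual q w) := by
  obtain ⟨p, u, rfl⟩ := exists_toDual_eq x
  exact (f.differentiable ((p, q), (⟨1, one_pos⟩, ⟨1, one_pos⟩))).comp
    (f := fun w : DualLevel N₂ q => (u, w)) ((differentiable_const u).prodMk differentiable_id)

theorem hasDerivAt_snd_slice (f : TestSpace₂ θ₁ θ₂ N₁ N₂) (x : StrongDual ℂ N₁) {q : ℕ}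
    (w h : DualLevel N₂ q) (t : ℂ) :
    HasDerivAt (fun t : ℂ => f (x, toDual q w + t • toDual q h))
      (fderiv ℂ (fun w : DualLevel N₂ q => f (x, toDual q w)) (w + t • h) h) t := by
  have h1 : HasDerivAt (fun t : ℂ => w + t • h) h t := by
    simpa using ((hasDerivAt_id t).smul_const h).const_add w
  have h2 := ((differentiable_snd_slice f x q) (w + t • h)).hasFDerivAt.comp_hasDerivAt t h1
  simpa only [Function.comp_def, map_add, map_smul] using h2

/-- Cauchy's estimate for the directional derivative. -/
theorem norm_deriv_snd_slice_le (f : TestSpace₂ θ₁ θ₂ N₁ N₂) (x : StrongDual ℂ N₁) {q : ℕ}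
    (w h : DualLevel N₂ q) {r M : ℝ} (hr : 0 < r)
    (hM : ∀ v : DualLevel N₂ q, ‖v‖ ≤ ‖w‖ + r → ‖f (x, toDual q v)‖ ≤ M) :
    ‖deriv (fun t : ℂ => f (x, toDual q w + t • toDual q h)) 0‖ ≤ M * (‖h‖ / r) := by
  rcases eq_or_ne h 0 with rfl | hh
  · rw [(hasDerivAt_snd_slice f x w 0 0).deriv]
    simp
  have hh0 : 0 < ‖h‖ := norm_pos_iff.2 hh
  have := Complex.norm_deriv_le_of_forall_mem_sphere_norm_le (c := 0) (R := r / ‖h‖) (C := M)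
    (f := fun t : ℂ => f (x, toDual q w + t • toDual q h)) (by positivity)
    (Differentiable.diffContOnCl fun t => (hasDerivAt_snd_slice f x w h t).differentiableAt)
    fun t ht => ?_
  · rwa [div_div_eq_mul_div, mul_div_assoc] at this
  · rw [← map_smul, ← map_add]
    refine hM _ ((norm_add_le _ _).trans ?_)
    rw [norm_smul, mem_sphere_zero_iff_norm.1 ht, div_mul_cancel₀ _ hh0.ne']

/-- The distribution `f ↦ d/dt f(0, t h)` at `t = 0`. -/
def derivDelta (h : StrongDual ℂ N₂) : Distribution₂ θ₁ θ₂ N₁ N₂ :=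
  Distribution₂.ofBound
    { toFun := fun f => deriv (fun t : ℂ => f (0, t • h)) 0
      map_add' := fun f g =>
        deriv_add (differentiable_line_right f h 0) (differentiable_line_right g h 0)
      map_smul' := fun c f => deriv_const_mul c (differentiable_line_right f h 0) } (by
    obtain ⟨q, v, rfl⟩ := exists_toDual_eq h
    refine ⟨((0, q), (⟨1, one_pos⟩, ⟨1, one_pos⟩)), Real.exp (θ₂ 1) * ‖v‖, fun f => ?_⟩
    have h1 := norm_deriv_snd_slice_le f 0 0 v one_pos
      (M := testNorm₂ ((0, q), (⟨1, one_pos⟩, ⟨1, one_pos⟩)) f * Real.exp (θ₂ 1)) fun w hw => by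
        have h2 := f.norm_le ((0, q), (⟨1, one_pos⟩, ⟨1, one_pos⟩)) (0, w)
        simp only [map_zero, norm_zero, mul_zero, one_mul] at h2
        rw [θ₁.map_zero, zero_add] at h2
        refine h2.trans (mul_le_mul_of_nonneg_left (Real.exp_le_exp.2 ?_) (apply_nonneg _ _))
        exact θ₂.mono (norm_nonneg w) (by simpa using hw)
    simp only [map_zero, zero_add, div_one] at h1
    refine le_trans (le_of_eq ?_) (h1.trans_eq (by ring))
    rfl)

/-- The directional derivative `(∂_h f)(x, y) = d/dt f(x, y + t h)` at `t = 0`, as an operator on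
test functions. It is a convolution operator, and so maps test functions to test functions. -/
def partialSnd (h : StrongDual ℂ N₂) : TestSpace₂ θ₁ θ₂ N₁ N₂ →ₗ[ℂ] TestSpace₂ θ₁ θ₂ N₁ N₂ where
  toFun := convTest (derivDelta h)
  map_add' f g := Growth.ext fun z => map_add (derivDelta h) (translate z f) (translate z g)
  map_smul' c f := Growth.ext fun z => map_smul (derivDelta h) c (translate z f)

theorem partialSnd_apply (h : StrongDual ℂ N₂) (f : TestSpace₂ θ₁ θ₂ N₁ N₂)
    (x : StrongDual ℂ N₁) (y : StrongDual ℂ N₂) :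
    partialSnd h f (x, y) = deriv (fun t : ℂ => f (x, y + t • h)) 0 := by
  change deriv (fun t : ℂ => f ((0, t • h) + (x, y))) 0 = _
  refine congrArg (fun g : ℂ → ℂ => deriv g 0) (funext fun t => ?_)
  rw [Prod.mk_add_mk, zero_add, add_comm]

theorem partialSnd_apply_toDual (f : TestSpace₂ θ₁ θ₂ N₁ N₂) (x : StrongDual ℂ N₁) {q : ℕ}
    (w h : DualLevel N₂ q) : partialSnd (toDual q h) f (x, toDual q w) =
      fderiv ℂ (fun w : DualLevel N₂ q => f (x, toDual q w)) w h := by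
  rw [partialSnd_apply, (hasDerivAt_snd_slice f x w h 0).deriv]
  refine congrArg
    (fun p => fderiv ℂ (fun w : DualLevel N₂ q => f (x, toDual q w)) p h) ?_
  exact (congrArg (w + ·) (zero_smul ℂ h)).trans (add_zero w)

/-- The iterated directional derivative `∂_{v 0} ⋯ ∂_{v (n - 1)}`. -/
def iterPartialSnd {q : ℕ} : (n : ℕ) → (Fin n → DualLevel N₂ q) →
    TestSpace₂ θ₁ θ₂ N₁ N₂ →ₗ[ℂ] TestSpace₂ θ₁ θ₂ N₁ N₂
  | 0, _ => LinearMap.id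
  | n + 1, v => (iterPartialSnd n (Fin.tail v)).comp (partialSnd (toDual q (v 0)))

/-- Cauchy's estimate for iterated directional derivatives: one step of length `r` for each. -/
theorem norm_iterPartialSnd_le {q : ℕ} (x : StrongDual ℂ N₁) {r : ℝ} (hr : 0 < r) (n : ℕ) :
    ∀ (v : Fin n → DualLevel N₂ q) (f : TestSpace₂ θ₁ θ₂ N₁ N₂) (w : DualLevel N₂ q) (M : ℝ),
      (∀ w' : DualLevel N₂ q, ‖w'‖ ≤ ‖w‖ + n * r → ‖f (x, toDual q w')‖ ≤ M) →
      ‖iterPartialSnd n v f (x, toDual q w)‖ ≤ M * ∏ k, (‖v k‖ / r) := by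
  induction n with
  | zero =>
    intro v f w M hM
    rw [Fin.prod_univ_zero, mul_one]
    exact hM w (by simp)
  | succ n ih =>
    intro v f w M hM
    rw [Fin.prod_univ_succ, ← mul_assoc]
    refine ih (Fin.tail v) (partialSnd (toDual q (v 0)) f) w _ fun w' hw' => ?_
    rw [partialSnd_apply]
    refine norm_deriv_snd_slice_le f x w' (v 0) hr fun w'' hw'' => hM w'' ?_
    push_cast
    linarith

/-- The growth condition bounds a test function on balls of a slice. -/
theorem exists_bound_snd_slice (f : TestSpace₂ θ₁ θ₂ N₁ N₂) (x : StrongDual ℂ N₁) (q : ℕ) (R : ℝ) :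
    ∃ M : ℝ, ∀ w : DualLevel N₂ q, ‖w‖ ≤ R → ‖f (x, toDual q w)‖ ≤ M := by
  obtain ⟨p, u, rfl⟩ := exists_toDual_eq x
  refine ⟨testNorm₂ ((p, q), (⟨1, one_pos⟩, ⟨1, one_pos⟩)) f *
    Real.exp (θ₁ (1 * ‖u‖) + θ₂ (1 * R)),
    fun w hw => (f.norm_le ((p, q), (⟨1, one_pos⟩, ⟨1, one_pos⟩)) (u, w)).trans ?_⟩
  refine mul_le_mul_of_nonneg_left (Real.exp_le_exp.2 (add_le_add le_rfl ?_)) (apply_nonneg _ _)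
  simp only [one_mul]
  exact θ₂.mono (norm_nonneg w) hw

theorem exists_toDual_eq₃ (x y z : StrongDual ℂ N₂) : ∃ (q : ℕ) (u v w : DualLevel N₂ q),
    toDual q u = x ∧ toDual q v = y ∧ toDual q w = z := by
  obtain ⟨k, u, rfl⟩ := exists_toDual_eq x
  obtain ⟨l, v, rfl⟩ := exists_toDual_eq y
  obtain ⟨m, w, rfl⟩ := exists_toDual_eq z
  exact ⟨max k (max l m), lift (le_max_left _ _) u,
    lift ((le_max_left l m).trans (le_max_right _ _)) v,
    lift ((le_max_right l m).trans (le_max_right _ _)) w,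
    toDual_lift _ u, toDual_lift _ v, toDual_lift _ w⟩

theorem partialSnd_add (h h' : StrongDual ℂ N₂) (f : TestSpace₂ θ₁ θ₂ N₁ N₂) :
    partialSnd (h + h') f = partialSnd h f + partialSnd h' f := by
  refine Growth.ext fun ⟨x, y⟩ => ?_
  obtain ⟨q, u, v, w, rfl, rfl, rfl⟩ := exists_toDual_eq₃ h h' y
  rw [Growth.add_apply, ← map_add, partialSnd_apply_toDual, partialSnd_apply_toDual,
    partialSnd_apply_toDual, map_add]

theorem partialSnd_smul (c : ℂ) (h : StrongDual ℂ N₂) (f : TestSpace₂ θ₁ θ₂ N₁ N₂) :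
    partialSnd (c • h) f = c • partialSnd h f := by
  refine Growth.ext fun ⟨x, y⟩ => ?_
  obtain ⟨q, u, -, w, rfl, -, rfl⟩ := exists_toDual_eq₃ h h y
  rw [Growth.smul_apply, ← map_smul, partialSnd_apply_toDual, partialSnd_apply_toDual, map_smul,
    smul_eq_mul]

/-- `w ↦ (∂_{v 0} ⋯ ∂_{v (n - 1)} ∂_w f)(x, y)` as a continuous linear functional. -/
theorem exists_iterPartialSnd_eq {q n : ℕ} (v : Fin n → DualLevel N₂ q)
    (f : TestSpace₂ θ₁ θ₂ N₁ N₂) (x : StrongDual ℂ N₁) (y : DualLevel N₂ q) :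
    ∃ L : StrongDual ℂ (DualLevel N₂ q), ∀ w,
      L w = iterPartialSnd n v (partialSnd (toDual q w) f) (x, toDual q y) := by
  obtain ⟨M, hM⟩ := exists_bound_snd_slice f x q (‖y‖ + (n + 1 : ℕ) * 1)
  refine ⟨LinearMap.mkContinuous
    { toFun := fun w => iterPartialSnd n v (partialSnd (toDual q w) f) (x, toDual q y)
      map_add' := fun w w' => by
        rw [map_add, partialSnd_add, map_add, Growth.add_apply]
      map_smul' := fun c w => by
        rw [map_smul, partialSnd_smul, map_smul, Growth.smul_apply]
        rfl } (M * ∏ k, (‖v k‖ / 1)) fun w => ?_, fun w => rfl⟩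
  refine (norm_iterPartialSnd_le x one_pos (n + 1) (Fin.cons w v) f y M hM).trans_eq ?_
  rw [Fin.prod_univ_succ]
  simp only [Fin.cons_zero, Fin.cons_succ, div_one]
  ring

end Deriv

/-! ### Taylor expansion along a nuclear series -/

section Taylor

theorem hasSum_prod_fin {I : Type*} {x : I → ℝ} {S : ℝ} (hx0 : ∀ i, 0 ≤ x i) (hx : HasSum x S)
    (n : ℕ) : HasSum (fun i : Fin n → I => ∏ k, x (i k)) (S ^ n) := by
  induction n with
  | zero =>
    have := hasSum_unique fun i : Fin 0 → I => ∏ k, x (i k)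
    rwa [Fin.prod_univ_zero] at this
  | succ n ih =>
    rw [← (Fin.consEquiv fun _ : Fin (n + 1) => I).hasSum_iff, pow_succ']
    have h0 : (0 : (Fin n → I) → ℝ) ≤ fun i => ∏ k, x (i k) := fun i =>
      Finset.prod_nonneg fun k _ => hx0 (i k)
    have h1 : 0 ≤ x := hx0
    have hs := hx.summable.mul_of_nonneg ih.summable h1 h0
    refine (hx.mul ih hs).congr_fun fun i => ?_
    exact Fin.prod_univ_succ fun k => x (Fin.cons (α := fun _ => I) i.1 i.2 k)

variable {θ₁ θ₂ : YoungFunction} {N₁ N₂ : Type*}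
  [AddCommGroup N₁] [Module ℂ N₁] [HilbertianScale N₁] [UniformSpace N₁] [IsNuclearFrechet N₁]
  [AddCommGroup N₂] [Module ℂ N₂] [HilbertianScale N₂] [UniformSpace N₂] [IsNuclearFrechet N₂]

/-- The `n`-th derivative in the direction `z = ∑ a_i h_i`, expanded by multilinearity. -/
theorem hasSum_iterPartialSnd {I : Type*} {q : ℕ} {a : I → ℂ} {h : I → DualLevel N₂ q}
    {z : DualLevel N₂ q} (hs : Summable fun i => ‖a i‖ * ‖h i‖) (hz : HasSum (fun i => a i • h i) z)
    (x : StrongDual ℂ N₁) (y : DualLevel N₂ q) (n : ℕ) : ∀ f : TestSpace₂ θ₁ θ₂ N₁ N₂,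
    HasSum (fun i : Fin n → I => (∏ k, a (i k)) * iterPartialSnd n (h ∘ i) f (x, toDual q y))
      (iterPartialSnd n (fun _ => z) f (x, toDual q y)) := by
  induction n with
  | zero =>
    intro f
    have := hasSum_unique fun i : Fin 0 → I =>
      (∏ k, a (i k)) * iterPartialSnd 0 (h ∘ i) f (x, toDual q y)
    rwa [Fin.prod_univ_zero, one_mul] at this
  | succ n ih =>
    intro f
    obtain ⟨M, hM⟩ := exists_bound_snd_slice f x q (‖y‖ + (n + 1 : ℕ) * 1)
    have hsum : Summable fun i : Fin (n + 1) → I =>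
        (∏ k, a (i k)) * iterPartialSnd (n + 1) (h ∘ i) f (x, toDual q y) := by
      refine Summable.of_norm_bounded ((hasSum_prod_fin (fun i => by positivity) hs.hasSum
        (n + 1)).summable.mul_left M) fun i => ?_
      rw [norm_mul, norm_prod, Finset.prod_mul_distrib, mul_left_comm]
      refine mul_le_mul_of_nonneg_left ?_ (Finset.prod_nonneg fun k _ => norm_nonneg _)
      refine (norm_iterPartialSnd_le x one_pos (n + 1) (h ∘ i) f y M hM).trans_eq ?_
      simp only [Function.comp_apply, div_one]
    let e : (Fin n → I) × I ≃ (Fin (n + 1) → I) :=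
      (Equiv.prodComm _ _).trans (Fin.consEquiv fun _ : Fin (n + 1) => I)
    have htot := (e.hasSum_iff.2 hsum.hasSum).prod_fiberwise
      (g := fun i => (∏ k, a (i k)) *
        iterPartialSnd n (h ∘ i) (partialSnd (toDual q z) f) (x, toDual q y)) fun i => by
      obtain ⟨L, hL⟩ := exists_iterPartialSnd_eq (h ∘ i) f x y
      rw [← hL]
      refine ((hz.mapL L).mul_left _).congr_fun fun j => ?_
      have hp : ∏ k, a (e (i, j) k) = a j * ∏ k, a (i k) :=
        Fin.prod_univ_succ fun k => a (e (i, j) k)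
      have hd : iterPartialSnd (n + 1) (h ∘ e (i, j)) f (x, toDual q y) = L (h j) :=
        (hL (h j)).symm
      rw [Function.comp_apply, hp, hd, map_smul, smul_eq_mul]
      ring
    have hu := htot.unique (ih (partialSnd (toDual q z) f))
    have hfin := hsum.hasSum
    rw [hu] at hfin
    exact hfin

theorem iteratedDeriv_snd_slice (x : StrongDual ℂ N₁) {q : ℕ} (z : DualLevel N₂ q) (n : ℕ) :
    ∀ f : TestSpace₂ θ₁ θ₂ N₁ N₂, iteratedDeriv n (fun t : ℂ => f (x, t • toDual q z)) =
      fun t : ℂ => iterPartialSnd n (fun _ => z) f (x, t • toDual q z) := by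
  induction n with
  | zero => exact fun f => iteratedDeriv_zero
  | succ n ih =>
    intro f
    rw [iteratedDeriv_succ']
    have e : deriv (fun t : ℂ => f (x, t • toDual q z)) =
        fun t : ℂ => partialSnd (toDual q z) f (x, t • toDual q z) := by
      funext t
      have h1 := hasDerivAt_snd_slice f x 0 z t
      simp only [map_zero, zero_add] at h1
      rw [h1.deriv, ← map_smul, partialSnd_apply_toDual]
    rw [e]
    exact ih (partialSnd (toDual q z) f)

/-- The Taylor expansion at `0`, in the second variable, at a point `z = ∑ a_i h_i`. -/
theorem hasSum_taylor_snd {I : Type*} {q : ℕ} {a : I → ℂ} {h : I → DualLevel N₂ q}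
    {z : DualLevel N₂ q} (hs : Summable fun i => ‖a i‖ * ‖h i‖) (hz : HasSum (fun i => a i • h i) z)
    (x : StrongDual ℂ N₁) (f : TestSpace₂ θ₁ θ₂ N₁ N₂)
    (hsum : Summable fun i : Σ n : ℕ, Fin n → I => ((i.1.factorial : ℂ)⁻¹ * ∏ k, a (i.2 k)) *
      iterPartialSnd i.1 (h ∘ i.2) f (x, 0)) :
    HasSum (fun i : Σ n : ℕ, Fin n → I => ((i.1.factorial : ℂ)⁻¹ * ∏ k, a (i.2 k)) *
      iterPartialSnd i.1 (h ∘ i.2) f (x, 0)) (f (x, toDual q z)) := by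
  have h1 := hsum.hasSum.sigma
    (g := fun n => (n.factorial : ℂ)⁻¹ * iterPartialSnd n (fun _ => z) f (x, 0)) fun n => by
    have := (hasSum_iterPartialSnd hs hz x 0 n f).mul_left (n.factorial : ℂ)⁻¹
    rw [map_zero] at this
    refine this.congr_fun fun i => ?_
    rw [mul_assoc]
  have hd : Differentiable ℂ fun t : ℂ => f (x, t • toDual q z) := fun t => by
    have := (hasDerivAt_snd_slice f x 0 z t).differentiableAt
    simpa only [map_zero, zero_add] using this
  have h2 := Complex.hasSum_taylorSeries_of_entire hd 0 1
  have e0 : (0 : ℂ) • toDual q z = 0 := zero_smul ℂ (toDual q z)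
  have e1 : (1 : ℂ) • toDual q z = toDual q z := one_smul ℂ (toDual q z)
  simp only [iteratedDeriv_snd_slice, sub_zero, one_pow, one_mul, smul_eq_mul, e0, e1] at h2
  rw [← h1.unique h2]
  exact hsum.hasSum

end Taylor

/-! ### Nuclear expansion of test functions of two variables -/

section Expansion

variable {θ θ₁ θ₂ : YoungFunction} {N N₁ : Type*} {N₂ : Type u}
  [AddCommGroup N] [Module ℂ N] [HilbertianScale N] [UniformSpace N] [IsNuclearFrechet N]
  [AddCommGroup N₁] [Module ℂ N₁] [HilbertianScale N₁] [UniformSpace N₁] [IsNuclearFrechet N₁]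
  [AddCommGroup N₂] [Module ℂ N₂] [HilbertianScale N₂] [UniformSpace N₂] [IsNuclearFrechet N₂]

/-- The restriction `x ↦ f(x, 0)`. -/
def restrictFst : TestSpace₂ θ₁ θ₂ N₁ N₂ →ₗ[ℂ] TestSpace θ₁ N₁ where
  toFun f := ⟨fun x => f (x, 0), fun k => by
    have e : ∀ z : DualLevel N₁ k.1, f (toDual k.1 z, 0) = f (toDual k.1 z, toDual 0 0) :=
      fun z => by rw [map_zero]
    simp only [e]
    refine ⟨(f.differentiable ((k.1, 0), (k.2, ⟨1, one_pos⟩))).comp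
      (f := fun z : DualLevel N₁ k.1 => (z, (0 : DualLevel N₂ 0)))
      (differentiable_id.prodMk (differentiable_const _)),
      testNorm₂ ((k.1, 0), (k.2, ⟨1, one_pos⟩)) f, fun z =>
      (f.norm_le ((k.1, 0), (k.2, ⟨1, one_pos⟩)) (z, 0)).trans_eq ?_⟩
    simp only [norm_zero, mul_zero, θ₂.map_zero, add_zero]⟩
  map_add' _ _ := rfl
  map_smul' _ _ := rfl

theorem norm_prod_apply_le {n : ℕ} (ξ : Fin n → N) {p : ℕ} (z : DualLevel N p) :
    ‖∏ k, toDual p z (ξ k)‖ ≤ (∏ k, ‖toLevel p (ξ k)‖) * ‖z‖ ^ n := by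
  rw [norm_prod]
  calc ∏ k, ‖toDual p z (ξ k)‖ ≤ ∏ k, (‖toLevel p (ξ k)‖ * ‖z‖) :=
        Finset.prod_le_prod (fun k _ => norm_nonneg _) fun k _ =>
          (z.le_opNorm (toLevel p (ξ k))).trans_eq (mul_comm _ _)
    _ = _ := by rw [Finset.prod_mul_distrib, Finset.prod_const, Finset.card_univ, Fintype.card_fin]

/-- The monomial `z ↦ ⟨z, ξ_0⟩ ⋯ ⟨z, ξ_{n-1}⟩`. -/
def monomial (θ : YoungFunction) {n : ℕ} (ξ : Fin n → N) : TestSpace θ N :=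
  ⟨fun z => ∏ k, z (ξ k), fun l => by
    refine ⟨?_, ?_⟩
    · refine (contDiff_prod (n := 1) (f := fun k (z : DualLevel N l.1) => toDual l.1 z (ξ k))
        fun k _ => ?_).differentiable one_ne_zero
      exact (ContinuousLinearMap.apply ℂ ℂ (toLevel l.1 (ξ k))).contDiff
    · obtain ⟨C, hC⟩ := θ.exists_linear_le l.2.2 1 zero_le_one
      refine ⟨(∏ k, ‖toLevel l.1 (ξ k)‖) * (n.factorial * Real.exp C), fun z => ?_⟩
      refine (norm_prod_apply_le ξ z).trans ?_
      rw [mul_assoc, mul_assoc, ← Real.exp_add]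
      refine mul_le_mul_of_nonneg_left ?_ (Finset.prod_nonneg fun k _ => norm_nonneg _)
      have h1 := Real.pow_div_factorial_le_exp ‖z‖ (norm_nonneg z) n
      rw [div_le_iff₀' (by positivity)] at h1
      refine h1.trans (mul_le_mul_of_nonneg_left (Real.exp_le_exp.2 ?_) (by positivity))
      simpa using hC ‖z‖ (norm_nonneg z)⟩

/-- Cauchy's estimate for the Taylor coefficients in the second variable. Keeping the radius `R`
free is what lets it be matched against the growth of the monomials. -/
theorem testNorm_restrictFst_iterPartialSnd_le (f : TestSpace₂ θ₁ θ₂ N₁ N₂) (p q : ℕ) (a b : Pos)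
    {n : ℕ} (v : Fin n → DualLevel N₂ q) {R : ℝ} (hR : 0 ≤ R) :
    testNorm (p, a) (restrictFst (iterPartialSnd n v f)) * R ^ n ≤
      testNorm₂ ((p, q), (a, b)) f * Real.exp (θ₂ (b * R)) *
        (((n : ℝ) + 1) ^ n * ∏ k, ‖v k‖) := by
  have hfb : ∀ (u : DualLevel N₁ p) (w : DualLevel N₂ q), ‖w‖ ≤ R →
      ‖f (toDual p u, toDual q w)‖ ≤
        testNorm₂ ((p, q), (a, b)) f * Real.exp (θ₂ (b * R)) * Real.exp (θ₁ (a * ‖u‖)) := by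
    intro u w hw
    refine (f.norm_le ((p, q), (a, b)) (u, w)).trans ?_
    rw [mul_assoc, ← Real.exp_add, add_comm]
    refine mul_le_mul_of_nonneg_left (Real.exp_le_exp.2 (add_le_add ?_ le_rfl)) (apply_nonneg _ _)
    exact θ₂.mono (mul_nonneg b.2.le (norm_nonneg w)) (mul_le_mul_of_nonneg_left hw b.2.le)
  have hM0 : 0 ≤ testNorm₂ ((p, q), (a, b)) f * Real.exp (θ₂ (b * R)) :=
    mul_nonneg (apply_nonneg _ _) (Real.exp_nonneg _)
  rcases n.eq_zero_or_pos with rfl | hn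
  · simp only [pow_zero, mul_one, Fin.prod_univ_zero]
    refine growthNorm_le fun u => ?_
    have := hfb u 0 (by simpa using hR)
    rwa [map_zero] at this
  rcases hR.eq_or_lt with rfl | hR
  · rw [zero_pow hn.ne', mul_zero]
    exact mul_nonneg hM0 (mul_nonneg (by positivity) (Finset.prod_nonneg fun k _ => norm_nonneg _))
  have hr : 0 < R / ((n : ℝ) + 1) := by positivity
  rw [← le_div_iff₀ (by positivity)]
  refine growthNorm_le fun u => ?_
  have h1 := norm_iterPartialSnd_le (toDual p u) hr n v f 0 _ fun w hw => hfb u w (hw.trans ?_)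
  · rw [map_zero] at h1
    refine h1.trans_eq ?_
    simp only [div_div_eq_mul_div, mul_div_assoc]
    rw [Finset.prod_mul_distrib, Finset.prod_const, Finset.card_univ, Fintype.card_fin, div_pow]
    ring
  · rw [norm_zero, zero_add, mul_div_assoc', div_le_iff₀ (by positivity)]
    nlinarith

theorem succ_pow_div_factorial_le (n : ℕ) :
    ((n : ℝ) + 1) ^ n / n.factorial ≤ Real.exp 1 * Real.exp 1 ^ n := by
  have h := Real.pow_div_factorial_le_exp ((n + 1 : ℕ) : ℝ) (Nat.cast_nonneg _) (n + 1)
  have e : ((n + 1 : ℕ) : ℝ) ^ (n + 1) / (n + 1).factorial = ((n : ℝ) + 1) ^ n / n.factorial := by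
    rw [Nat.factorial_succ]
    push_cast
    field_simp
    ring
  rw [e] at h
  refine h.trans_eq ?_
  rw [← Real.exp_one_pow, pow_succ']

/-- The iterated derivatives in the second variable only see the slice `{x} × N₂'`. -/
theorem iterPartialSnd_eq_mul {q : ℕ} (n : ℕ) : ∀ (v : Fin n → DualLevel N₂ q)
    (f g : TestSpace₂ θ₁ θ₂ N₁ N₂) (c : ℂ) (x x' : StrongDual ℂ N₁),
    (∀ y, f (x, y) = c * g (x', y)) →
      ∀ y, iterPartialSnd n v f (x, y) = c * iterPartialSnd n v g (x', y) := by
  induction n with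
  | zero => exact fun _ _ _ _ _ _ h => h
  | succ n ih =>
    intro v f g c x x' h
    refine ih (Fin.tail v) _ _ c x x' fun y => ?_
    rw [partialSnd_apply, partialSnd_apply]
    simp only [h]
    exact deriv_const_mul_field c

/-- The nuclear expansion `f(x, z) = ∑ (D_j f)(x) m_j(z)` of test functions of two variables, with
norms controlled on a prescribed pair of levels. On a tensor product `φ ⊗ ψ`, the operator `D_j` is
the multiplication of `φ` by a coefficient of `ψ`. -/
theorem exists_nuclear_expansion (θ₁ θ₂ : YoungFunction) (N₁ : Type*) (N₂ : Type u)
    [AddCommGroup N₁] [Module ℂ N₁] [HilbertianScale N₁] [UniformSpace N₁] [IsNuclearFrechet N₁]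
    [AddCommGroup N₂] [Module ℂ N₂] [HilbertianScale N₂] [UniformSpace N₂] [IsNuclearFrechet N₂]
    (k l : ℕ × Pos) :
    ∃ (k' : (ℕ × ℕ) × (Pos × Pos)) (J : Type u)
      (D : J → TestSpace₂ θ₁ θ₂ N₁ N₂ →ₗ[ℂ] TestSpace θ₁ N₁) (m : J → TestSpace θ₂ N₂) (s : J → ℝ),
      Summable s ∧
      (∀ j f, testNorm k (D j f) * testNorm l (m j) ≤ s j * testNorm₂ k' f) ∧
      (∀ f u z, HasSum (fun j => D j f (toDual k.1 u) * m j (toDual l.1 z))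
        (f (toDual k.1 u, toDual l.1 z))) ∧
      ∀ ψ, ∃ c : J → ℂ, ∀ j φ, D j (tensor φ ψ) = c j • φ := by
  obtain ⟨p, a⟩ := k
  obtain ⟨q, b⟩ := l
  obtain ⟨r, hqr, I, ξ, h, hs, hξ⟩ := exists_nuclear_lift N₂ q
  set S : ℝ := ∑' i, ‖toLevel q (ξ i)‖ * ‖h i‖
  have hS : 0 ≤ S := tsum_nonneg fun i => by positivity
  -- The scale `ε` of the new norm makes the geometric series of ratio `e ε S` converge.
  obtain ⟨ε, hε, hεS⟩ : ∃ ε : ℝ, 0 < ε ∧ Real.exp 1 * ε * S < 1 := by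
    refine ⟨(Real.exp 1 * (S + 1))⁻¹, by positivity, ?_⟩
    rw [mul_inv, ← mul_assoc, mul_inv_cancel₀ (Real.exp_pos 1).ne', one_mul,
      inv_mul_lt_iff₀ (by positivity)]
    linarith
  let b' : Pos := ⟨ε * b, mul_pos hε b.2⟩
  let J : Type u := Σ n : ℕ, Fin n → I
  let D : J → TestSpace₂ θ₁ θ₂ N₁ N₂ →ₗ[ℂ] TestSpace θ₁ N₁ := fun j =>
    restrictFst.comp (iterPartialSnd j.1 (h ∘ j.2))
  let m : J → TestSpace θ₂ N₂ := fun j =>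
    (j.1.factorial : ℂ)⁻¹ • monomial θ₂ (ξ ∘ j.2)
  let s : J → ℝ := fun j =>
    Real.exp 1 * ∏ k, (Real.exp 1 * ε * (‖toLevel q (ξ (j.2 k))‖ * ‖h (j.2 k)‖))
  have hs0 : ∀ j, 0 ≤ s j := fun j =>
    mul_nonneg (Real.exp_nonneg _) (Finset.prod_nonneg fun k _ => by positivity)
  have hsum : Summable s := by
    have hn : ∀ n : ℕ, HasSum (fun i : Fin n → I => s ⟨n, i⟩)
        (Real.exp 1 * (Real.exp 1 * ε * S) ^ n) := fun n =>
      (hasSum_prod_fin (fun i => by positivity) (hs.hasSum.mul_left (Real.exp 1 * ε)) n).mul_left _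
    refine (summable_sigma_of_nonneg hs0).2 ⟨fun n => (hn n).summable, ?_⟩
    simp only [(hn _).tsum_eq]
    exact (summable_geometric_of_lt_one (by positivity) hεS).mul_left _
  have hm : ∀ (j : J) (z : DualLevel N₂ q), ‖m j (toDual q z)‖ ≤
      (j.1.factorial : ℝ)⁻¹ * ((∏ k, ‖toLevel q (ξ (j.2 k))‖) * ‖z‖ ^ j.1) := by
    intro j z
    refine (norm_mul _ _).trans_le ?_
    rw [norm_inv, Complex.norm_natCast]
    exact mul_le_mul_of_nonneg_left (norm_prod_apply_le (ξ ∘ j.2) z) (by positivity)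
  -- The radius `‖z‖ / ε` equates the exponents of the growth of `f` and of the weight at `z`.
  have key : ∀ (j : J) (f : TestSpace₂ θ₁ θ₂ N₁ N₂) (z : DualLevel N₂ q),
      testNorm (p, a) (D j f) * ‖m j (toDual q z)‖ ≤
        s j * testNorm₂ ((p, r), (a, b')) f * Real.exp (θ₂ (b * ‖z‖)) := by
    intro j f z
    have h1 := testNorm_restrictFst_iterPartialSnd_le f p r a b' (h ∘ j.2)
      (R := ‖z‖ / ε) (by positivity)
    have e1 : (b' : ℝ) * (‖z‖ / ε) = b * ‖z‖ := by
      change ε * b * (‖z‖ / ε) = b * ‖z‖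
      field_simp
    rw [e1] at h1
    have hP : 0 ≤ ∏ k, ‖toLevel q (ξ (j.2 k))‖ := Finset.prod_nonneg fun k _ => norm_nonneg _
    have hH : 0 ≤ ∏ k, ‖(h ∘ j.2) k‖ := Finset.prod_nonneg fun k _ => norm_nonneg _
    have hT : 0 ≤ testNorm₂ ((p, r), (a, b')) f := apply_nonneg _ _
    set A := testNorm (p, a) (D j f)
    have hA : 0 ≤ A := apply_nonneg _ _
    set T := testNorm₂ ((p, r), (a, b')) f
    set P := ∏ k, ‖toLevel q (ξ (j.2 k))‖
    set H := ∏ k, ‖(h ∘ j.2) k‖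
    set W := Real.exp (θ₂ (b * ‖z‖))
    have hW : 0 ≤ W := Real.exp_nonneg _
    have e2 : s j = Real.exp 1 * (Real.exp 1 ^ j.1 * ε ^ j.1 * (P * H)) := by
      simp only [s, Finset.prod_mul_distrib, Finset.prod_const, Finset.card_univ,
        Fintype.card_fin]
      rfl
    calc A * ‖m j (toDual q z)‖
        ≤ A * ((j.1.factorial : ℝ)⁻¹ * (P * ‖z‖ ^ j.1)) := mul_le_mul_of_nonneg_left (hm j z) hA
      _ = A * (‖z‖ / ε) ^ j.1 * (ε ^ j.1 * P * (j.1.factorial : ℝ)⁻¹) := by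
        rw [div_pow]
        field_simp
      _ ≤ T * W * (((j.1 : ℝ) + 1) ^ j.1 * H) * (ε ^ j.1 * P * (j.1.factorial : ℝ)⁻¹) :=
        mul_le_mul_of_nonneg_right h1 (by positivity)
      _ = ((j.1 : ℝ) + 1) ^ j.1 / j.1.factorial * (T * W * H * ε ^ j.1 * P) := by
        rw [div_eq_mul_inv]
        ring
      _ ≤ Real.exp 1 * Real.exp 1 ^ j.1 * (T * W * H * ε ^ j.1 * P) :=
        mul_le_mul_of_nonneg_right (succ_pow_div_factorial_le j.1) (by positivity)
      _ = s j * T * W := by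
        rw [e2]
        ring
  refine ⟨((p, r), (a, b')), J, D, m, s, hsum, fun j f => ?_, fun f u z => ?_, fun ψ => ?_⟩
  · have h1 : testNorm (q, b) (((testNorm (p, a) (D j f) : ℝ) : ℂ) • m j) ≤
        s j * testNorm₂ ((p, r), (a, b')) f := growthNorm_le fun z => by
      refine (norm_mul _ _).trans_le ?_
      rw [Complex.norm_real, Real.norm_of_nonneg (apply_nonneg _ _)]
      exact key j f z
    rwa [map_smul_eq_mul, Complex.norm_real, Real.norm_of_nonneg (apply_nonneg _ _)] at h1
  · have hz := hξ z
    have hzs : Summable fun i => ‖z (toLevel q (ξ i))‖ * ‖h i‖ := by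
      refine Summable.of_nonneg_of_le (fun i => by positivity) (fun i => ?_) (hs.mul_left ‖z‖)
      rw [← mul_assoc]
      exact mul_le_mul_of_nonneg_right (z.le_opNorm _) (norm_nonneg _)
    have et : ∀ j : J, D j f (toDual p u) * m j (toDual q z) =
        ((j.1.factorial : ℂ)⁻¹ * ∏ k, z (toLevel q (ξ (j.2 k)))) *
          iterPartialSnd j.1 (h ∘ j.2) f (toDual p u, 0) := fun j => mul_comm _ _
    have hsm : Summable fun j : J => D j f (toDual p u) * m j (toDual q z) := by
      refine Summable.of_norm_bounded (((hsum.mul_right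
        (testNorm₂ ((p, r), (a, b')) f)).mul_right (Real.exp (θ₂ (b * ‖z‖)))).mul_right
        (Real.exp (θ₁ (a * ‖u‖)))) fun j => ?_
      rw [norm_mul]
      calc ‖D j f (toDual p u)‖ * ‖m j (toDual q z)‖
          ≤ testNorm (p, a) (D j f) * Real.exp (θ₁ (a * ‖u‖)) * ‖m j (toDual q z)‖ :=
            mul_le_mul_of_nonneg_right ((D j f).norm_le (p, a) u) (norm_nonneg _)
        _ = testNorm (p, a) (D j f) * ‖m j (toDual q z)‖ * Real.exp (θ₁ (a * ‖u‖)) := by ring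
        _ ≤ _ := mul_le_mul_of_nonneg_right (key j f z) (Real.exp_nonneg _)
    simp only [et] at hsm ⊢
    have := hasSum_taylor_snd hzs hz (toDual p u) f hsm
    rwa [toDual_lift] at this
  · refine ⟨fun j => iterPartialSnd j.1 (h ∘ j.2)
      (tensor (expVec θ₁ (0 : N₁)) ψ : TestSpace₂ θ₁ θ₂ N₁ N₂) (0, 0), fun j φ => ?_⟩
    refine Growth.ext fun x => ?_
    have := iterPartialSnd_eq_mul j.1 (h ∘ j.2) (tensor φ ψ) (tensor (expVec θ₁ (0 : N₁)) ψ) (φ x)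
      x 0 (fun y => by
        change φ x * ψ y = φ x * (Complex.exp ((0 : StrongDual ℂ N₁) 0) * ψ y)
        rw [map_zero, Complex.exp_zero, one_mul]) 0
    exact this.trans (mul_comm _ _)

end Expansion

/-! ### The kernel theorem -/

section Kernel

theorem growthNorm_sub_sum_le {κ V J : Type*} {E : κ → Type*} [∀ k, NormedAddCommGroup (E k)]
    [∀ k, NormedSpace ℂ (E k)] {ι : ∀ k, E k → V} {w : ∀ k, E k → ℝ} {k : κ} {ψ : Growth ι w}
    {c : J → ℂ} {m : J → Growth ι w} {t : J → ℝ} (ht : Summable t)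
    (hc : ∀ j, ‖c j‖ * growthNorm ι w k (m j) ≤ t j)
    (hs : ∀ z, HasSum (fun j => c j * m j (ι k z)) (ψ (ι k z))) (F : Finset J) :
    growthNorm ι w k (ψ - ∑ j ∈ F, c j • m j) ≤ ∑' j : {j // j ∉ F}, t j := by
  refine growthNorm_le fun z => ?_
  let ev : Growth ι w →ₗ[ℂ] ℂ :=
    { toFun := fun f => f (ι k z), map_add' := fun _ _ => rfl, map_smul' := fun _ _ => rfl }
  have e : (ψ - ∑ j ∈ F, c j • m j) (ι k z) = ψ (ι k z) - ∑ j ∈ F, c j * m j (ι k z) := by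
    change ev (ψ - ∑ j ∈ F, c j • m j) = _
    rw [map_sub, map_sum]
    rfl
  have h1 : HasSum (fun j : {j // j ∉ F} => c j * m j (ι k z))
      ((ψ - ∑ j ∈ F, c j • m j) (ι k z)) := by
    refine (F.hasSum_compl_iff (f := fun j => c j * m j (ι k z))).2 ?_
    rw [e, sub_add_cancel]
    exact hs z
  refine h1.norm_le_of_bounded ((ht.comp_injective Subtype.val_injective).hasSum.mul_right _)
    fun j => ?_
  rw [norm_mul]
  calc ‖c j‖ * ‖m j (ι k z)‖ ≤ ‖c j‖ * (growthNorm ι w k (m j) * Real.exp (w k z)) :=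
        mul_le_mul_of_nonneg_left ((m j).norm_le k z) (norm_nonneg _)
    _ ≤ t j * Real.exp (w k z) := by
        rw [← mul_assoc]
        exact mul_le_mul_of_nonneg_right (hc j) (Real.exp_nonneg _)

/-- A functional bounded for one of the norms can be applied termwise to an expansion that converges
pointwise, and absolutely for this norm. -/
theorem hasSum_apply_of_expansion {κ V J : Type*} {E : κ → Type*} [∀ k, NormedAddCommGroup (E k)]
    [∀ k, NormedSpace ℂ (E k)] {ι : ∀ k, E k → V} {w : ∀ k, E k → ℝ} {k : κ} {ψ : Growth ι w}
    {c : J → ℂ} {m : J → Growth ι w} {t : J → ℝ} (ht : Summable t)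
    (hc : ∀ j, ‖c j‖ * growthNorm ι w k (m j) ≤ t j)
    (hs : ∀ z, HasSum (fun j => c j * m j (ι k z)) (ψ (ι k z))) (L : Growth ι w →ₗ[ℂ] ℂ) {A : ℝ}
    (hA : 0 ≤ A) (hL : ∀ g, ‖L g‖ ≤ A * growthNorm ι w k g) :
    HasSum (fun j => c j * L (m j)) (L ψ) := by
  rw [HasSum, tendsto_iff_norm_sub_tendsto_zero]
  have hlim := (tendsto_tsum_compl_atTop_zero t).const_mul A
  rw [mul_zero] at hlim
  refine squeeze_zero (fun F => norm_nonneg _) (fun F => ?_) hlim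
  have e : ∑ j ∈ F, c j * L (m j) - L ψ = -L (ψ - ∑ j ∈ F, c j • m j) := by
    rw [map_sub, map_sum, neg_sub]
    simp only [map_smul, smul_eq_mul]
  rw [e, norm_neg]
  exact (hL _).trans (mul_le_mul_of_nonneg_left (growthNorm_sub_sum_le ht hc hs F) hA)

variable {θ₁ θ₂ : YoungFunction} {N₁ N₂ : Type*}
  [AddCommGroup N₁] [Module ℂ N₁] [HilbertianScale N₁] [UniformSpace N₁] [IsNuclearFrechet N₁]
  [AddCommGroup N₂] [Module ℂ N₂] [HilbertianScale N₂] [UniformSpace N₂] [IsNuclearFrechet N₂]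

/-- A bilinear form bounded for a pair of norms defines a distribution when it is applied termwise
to a nuclear expansion. -/
theorem exists_distribution_hasSum (Ξ : Operators θ₁ θ₂ N₁ N₂) {k l : ℕ × Pos} {C : ℝ} (hC0 : 0 ≤ C)
    (hC : ∀ φ ψ, ‖Ξ φ ψ‖ ≤ C * testNorm k φ * testNorm l ψ) {k' : (ℕ × ℕ) × (Pos × Pos)}
    {J : Type*} (D : J → TestSpace₂ θ₁ θ₂ N₁ N₂ →ₗ[ℂ] TestSpace θ₁ N₁) (m : J → TestSpace θ₂ N₂)
    {s : J → ℝ} (hs : Summable s)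
    (hDm : ∀ j f, testNorm k (D j f) * testNorm l (m j) ≤ s j * testNorm₂ k' f) :
    ∃ K : Distribution₂ θ₁ θ₂ N₁ N₂, ∀ f, HasSum (fun j => Ξ (D j f) (m j)) (K f) := by
  have hb : ∀ f j, ‖Ξ (D j f) (m j)‖ ≤ s j * (C * testNorm₂ k' f) := fun f j => by
    refine (hC _ _).trans ?_
    rw [mul_assoc, mul_left_comm (s j)]
    exact mul_le_mul_of_nonneg_left (hDm j f) hC0
  have hsum : ∀ f, Summable fun j => Ξ (D j f) (m j) := fun f =>
    Summable.of_norm_bounded (hs.mul_right _) (hb f)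
  have hadd : ∀ f g, ∑' j, Ξ (D j (f + g)) (m j) =
      ∑' j, Ξ (D j f) (m j) + ∑' j, Ξ (D j g) (m j) := fun f g => by
    rw [← (hsum f).tsum_add (hsum g)]
    refine tsum_congr fun j => ?_
    rw [map_add, map_add]
    rfl
  have hsmul : ∀ (c : ℂ) f, ∑' j, Ξ (D j (c • f)) (m j) = c * ∑' j, Ξ (D j f) (m j) := fun c f => by
    rw [← tsum_mul_left]
    refine tsum_congr fun j => ?_
    rw [map_smul, map_smul]
    rfl
  refine ⟨Distribution₂.ofBound
    { toFun := fun f => ∑' j, Ξ (D j f) (m j), map_add' := hadd, map_smul' := hsmul }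
    ⟨k', (∑' j, s j) * C, fun f => ?_⟩, fun f => (hsum f).hasSum⟩
  rw [mul_assoc]
  exact tsum_of_norm_bounded (hs.hasSum.mul_right _) (hb f)

/-- The kernel theorem: the bilinear form `⟨⟨Ξ φ, ψ⟩⟩` is bounded for a pair of norms, so that it can
be applied termwise to the nuclear expansion `f = ∑ D_j f ⊗ m_j` of `f`. -/
theorem exists_isKernel (Ξ : Operators θ₁ θ₂ N₁ N₂) : ∃ K, IsKernel Ξ K := by
  obtain ⟨k, l, C, hC0, hC⟩ := Operators.exists_bound Ξ
  obtain ⟨k', J, D, m, s, hs, hDm, hexp, htens⟩ := exists_nuclear_expansion θ₁ θ₂ N₁ N₂ k l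
  obtain ⟨K, hK⟩ := exists_distribution_hasSum Ξ hC0 hC D m hs hDm
  refine ⟨K, fun φ ψ => ?_⟩
  obtain ⟨c, hc⟩ := htens ψ
  -- Testing against `1 ⊗ ψ` turns the expansion of two-variable functions into one of `ψ`.
  obtain ⟨one, hone⟩ : ∃ one : TestSpace θ₁ N₁, ∀ x, one x = 1 := ⟨expVec θ₁ 0, fun x => by
    change Complex.exp (x 0) = 1
    rw [map_zero, Complex.exp_zero]⟩
  have hct : ∀ j, ‖c j‖ * testNorm l (m j) ≤ s j * testNorm₂ k' (tensor one ψ) := fun j => by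
    refine le_trans (mul_le_mul_of_nonneg_right ?_ (apply_nonneg _ _)) (hDm j (tensor one ψ))
    have h1 := (D j (tensor one ψ)).norm_le k 0
    rw [hc, Growth.smul_apply, hone, mul_one, norm_zero, mul_zero, θ₁.map_zero, Real.exp_zero,
      mul_one] at h1
    rwa [hc]
  have hψ : ∀ z, HasSum (fun j => c j * m j (toDual l.1 z)) (ψ (toDual l.1 z)) := fun z => by
    have h1 := hexp (tensor one ψ) 0 z
    simp only [hc, Growth.smul_apply, hone, mul_one] at h1
    have e : tensor one ψ (toDual k.1 0, toDual l.1 z) = ψ (toDual l.1 z) := by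
      change one _ * ψ _ = _
      rw [hone, one_mul]
    rwa [e] at h1
  have h1 := hasSum_apply_of_expansion (hs.mul_right _) hct hψ (Ξ φ).toLinearMap
    (mul_nonneg hC0 (apply_nonneg (testNorm k) φ)) (hC φ)
  refine h1.unique ((hK (tensor φ ψ)).congr_fun fun j => ?_)
  rw [hc, map_smul]
  rfl

theorem isKernel_kernel (Ξ : Operators θ₁ θ₂ N₁ N₂) : IsKernel Ξ (kernel Ξ) := by
  rw [kernel, dif_pos (exists_isKernel Ξ)]
  exact (exists_isKernel Ξ).choose_spec

end Kernel

/-! ### Exponential functions -/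

section Exponential

variable {θ₁ θ₂ : YoungFunction} {N₁ N₂ : Type*}
  [AddCommGroup N₁] [Module ℂ N₁] [HilbertianScale N₁] [UniformSpace N₁] [IsNuclearFrechet N₁]
  [AddCommGroup N₂] [Module ℂ N₂] [HilbertianScale N₂] [UniformSpace N₂] [IsNuclearFrechet N₂]

/-- Exponential functions are eigenvectors of convolution operators. -/
theorem convTest_tensor_expVec (K : Distribution₂ θ₁ θ₂ N₁ N₂) (ξ₁ : N₁) (ξ₂ : N₂) :
    convTest K (tensor (expVec θ₁ ξ₁) (expVec θ₂ ξ₂)) =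
      K (tensor (expVec θ₁ ξ₁) (expVec θ₂ ξ₂)) • tensor (expVec θ₁ ξ₁) (expVec θ₂ ξ₂) := by
  refine Growth.ext fun z => ?_
  have e : translate z (tensor (expVec θ₁ ξ₁) (expVec θ₂ ξ₂)) =
      tensor (expVec θ₁ ξ₁) (expVec θ₂ ξ₂) z • tensor (expVec θ₁ ξ₁) (expVec θ₂ ξ₂) := by
    refine Growth.ext fun x => ?_
    change Complex.exp (x.1 ξ₁ + z.1 ξ₁) * Complex.exp (x.2 ξ₂ + z.2 ξ₂) =
      Complex.exp (z.1 ξ₁) * Complex.exp (z.2 ξ₂) * (Complex.exp (x.1 ξ₁) * Complex.exp (x.2 ξ₂))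
    rw [Complex.exp_add, Complex.exp_add]
    ring
  change K (translate z _) = _
  rw [e, map_smul, smul_eq_mul, Growth.smul_apply, mul_comm]

theorem coeff₂₀_tensor_expVec (ξ₁ : N₁) (ξ₂ : N₂) (x : StrongDual ℂ N₁) :
    coeff₂₀ (tensor (expVec θ₁ ξ₁) (expVec θ₂ ξ₂)) x = 2⁻¹ * (x ξ₁ * x ξ₁) := by
  have e : (fun t : ℂ => tensor (expVec θ₁ ξ₁) (expVec θ₂ ξ₂) (t • x, 0)) =
      fun t : ℂ => Complex.exp (x ξ₁ * t) := by
    funext t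
    change Complex.exp (t * x ξ₁) * Complex.exp 0 = _
    rw [Complex.exp_zero, mul_one, mul_comm]
  rw [coeff₂₀, e, iteratedDeriv_cexp_const_mul]
  simp [sq]

theorem coeff₀₂_tensor_expVec (ξ₁ : N₁) (ξ₂ : N₂) (y : StrongDual ℂ N₂) :
    coeff₀₂ (tensor (expVec θ₁ ξ₁) (expVec θ₂ ξ₂)) y = 2⁻¹ * (y ξ₂ * y ξ₂) := by
  have e : (fun t : ℂ => tensor (expVec θ₁ ξ₁) (expVec θ₂ ξ₂) (0, t • y)) =
      fun t : ℂ => Complex.exp (y ξ₂ * t) := by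
    funext t
    change Complex.exp 0 * Complex.exp (t * y ξ₂) = _
    rw [Complex.exp_zero, one_mul, mul_comm]
  rw [coeff₀₂, e, iteratedDeriv_cexp_const_mul]
  simp [sq]

theorem traceDistribution_tensor_expVec (ξ₁ : N₁) (ξ₂ : N₂) :
    (traceDistribution : Distribution₂ θ₁ θ₂ N₁ N₂) (tensor (expVec θ₁ ξ₁) (expVec θ₂ ξ₂)) =
      bilin ξ₁ ξ₁ + bilin ξ₂ ξ₂ := by
  change 2 * traceForm (coeff₂₀ (tensor (expVec θ₁ ξ₁) (expVec θ₂ ξ₂))) +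
    2 * traceForm (coeff₀₂ (tensor (expVec θ₁ ξ₁) (expVec θ₂ ξ₂))) = _
  simp only [traceForm, coeff₂₀_tensor_expVec, coeff₀₂_tensor_expVec, tsum_mul_left,
    (traceForm_tensor _ _).tsum_eq]
  ring

end Exponential

end WhiteNoise

end

open WhiteNoise
theorem proposition4p2 {N₁ N₂ : Type*}
    [AddCommGroup N₁] [Module ℂ N₁] [HilbertianScale N₁] [UniformSpace N₁] [IsNuclearFrechet N₁]
    [AddCommGroup N₂] [Module ℂ N₂] [HilbertianScale N₂] [UniformSpace N₂] [IsNuclearFrechet N₂]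
    (θ₁ θ₂ : YoungFunction) (Ξ : Operators θ₁ θ₂ N₁ N₂) (ξ₁ : N₁) (ξ₂ : N₂) :
    symbol (quantumGrossLaplacian Ξ) ξ₁ ξ₂ =
      (bilin ξ₁ ξ₁ + bilin ξ₂ ξ₂) * symbol Ξ ξ₁ ξ₂ := by
  change traceDistribution (convTest (kernel Ξ) (tensor (expVec θ₁ ξ₁) (expVec θ₂ ξ₂))) = _
  rw [convTest_tensor_expVec, map_smul, smul_eq_mul, traceDistribution_tensor_expVec, mul_comm,
    symbol, isKernel_kernel Ξ]
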